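/- Let $q\in\mathbb C^*$ not be a root of unity, let $k_+,k_-\in\mathbb C^*$, and put $\rho=k_+k_-(q+q^{-1})^2$. Write $[x,y]=xy-yx$, $[x,y]_q=q\,xy-q^{-1}yx$, and let $u,v$ be formal commuting variables (commuting with all coefficients), $U=\frac{qu^2+q^{-1}u^{-2}}{q+q^{-1}}$, $V=\frac{qv^2+q^{-1}v^{-2}}{q+q^{-1}}$. All currents are formal Laurent series, and a relation between currents means equality in the ring $S((u))((v))$ of formal Laurent series over the coefficient algebra $S$, i.e. equality of all coefficients. Let $$R(x)=\begin{pmatrix} xq-x^{-1}q^{-1}&0&0&0\\0&x-x^{-1}&q-q^{-1}&0\\0&q-q^{-1}&x-x^{-1}&0\\0&0&0&xq-x^{-1}q^{-1}\end{pmatrix}.$$ The reflection equation for a matrix $K(u)=\begin{pmatrix}A(u)&B(u)\\C(u)&D(u)\end{pmatrix}$ over $S((u))$ is $$R(u/v)\,(K(u)\otimes 1)\,R(uv)\,(1\otimes K(v))=(1\otimes K(v))\,R(uv)\,(K(u)\otimes 1)\,R(u/v).\tag{RE}$$ The current relations for $W_\pm(u),G_\pm(u)\in S((u))$ are, for all choices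 of signs (upper or lower throughout) and $\epsilon=\pm$: $$[W_\pm(u),W_\pm(v)]=0,\qquad [W_+(u),W_-(v)]+[W_-(u),W_+(v)]=0,$$ $$(U-V)[W_\pm(u),W_\mp(v)]=\tfrac{q-q^{-1}}{\rho(q+q^{-1})}\big(G_\pm(u)G_\mp(v)-G_\pm(v)G_\mp(u)\big)+\tfrac1{q+q^{-1}}\big(G_\pm(u)-G_\mp(u)+G_\mp(v)-G_\pm(v)\big),$$ $$W_\pm(u)W_\pm(v)-W_\mp(u)W_\mp(v)+\tfrac{1}{\rho(q^2-q^{-2})}[G_\pm(u),G_\mp(v)]+\tfrac{1-UV}{U-V}\big(W_\pm(u)W_\mp(v)-W_\pm(v)W_\mp(u)\big)=0,$$ $$U[G_\mp(v),W_\pm(u)]_q-V[G_\mp(u),W_\pm(v)]_q-(q-q^{-1})\big(W_\mp(u)G_\mp(v)-W_\mp(v)G_\mp(u)\big)+\rho\big(UW_\pm(u)-VW_\pm(v)-W_\mp(u)+W_\mp(v)\big)=0,$$ $$U[W_\mp(u),G_\mp(v)]_q-V[W_\mp(v),G_\mp(u)]_q-(q-q^{-1})\big(W_\pm(u)G_\mp(v)-W_\pm(v)G_\mp(u)\big)+\rho\big(UW_\mp(u)-VW_\mp(v)-W_\pm(u)+W_\pm(v)\big)=0,$$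 $$[G_\epsilon(u),W_\pm(v)]+[W_\pm(u),G_\epsilon(v)]=0,\quad [G_\pm(u),G_\pm(v)]=0,\quad [G_+(u),G_-(v)]+[G_-(u),G_+(v)]=0.$$ Consider the decomposition $$A(u)=uqW_+(u)-u^{-1}q^{-1}W_-(u),\qquad D(u)=uqW_-(u)-u^{-1}q^{-1}W_+(u),$$ $$B(u)=\tfrac{1}{k_-(q+q^{-1})}G_+(u)+\tfrac{k_+(q+q^{-1})}{q-q^{-1}},\qquad C(u)=\tfrac{1}{k_+(q+q^{-1})}G_-(u)+\tfrac{k_-(q+q^{-1})}{q-q^{-1}}.\tag{$*$}$$ Then: (1) For every unital associative $\mathbb C$-algebra $S$ and all $W_\pm(u),G_\pm(u)\in S((u))$, the matrix $K(u)$ defined by $(*)$ satisfies (RE) if and only if $W_\pm,G_\pm$ satisfy all the current relations. (2) Let $N,M$ be integers with $M\le 0$. Let $B_q(\widehat{sl_2})$ be the unital associative $\mathbb C$-algebra generated by the coefficients of $A(u)=\sum_{n\ge N}A_nu^n$, $D(u)=\sum_{n\ge N}D_nu^n$, $B(u)=\sum_{n\ge M}B_nu^n$, $C(u)=\sum_{n\ge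 M}C_nu^n$ with defining relations (RE), and let $O_q(\widehat{sl_2})$ be the unital associative $\mathbb C$-algebra generated by the coefficients of $W_\pm(u)=\sum_{n\ge N+1}W_{\pm,n}u^n$, $G_\pm(u)=\sum_{n\ge M}G_{\pm,n}u^n$ with the current relations as defining relations. (For $N=M=0$ the entries of $K(u)$ are formal power series.) Then there is exactly one algebra homomorphism $\Phi:B_q(\widehat{sl_2})\to O_q(\widehat{sl_2})$ given on the currents, coefficient by coefficient, by $(*)$, and $\Phi$ is an algebra isomorphism. -/

import Mathlib

open scoped Kronecker LaurentSeries

noncomputable section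

namespace ReflectionCurrent

/-! ### Formal Laurent series in one and in two spectral parameters -/

section Series

variable {S : Type*} [Ring S]

/-- Formal Laurent series `S((u))((v))` in two central variables `u` and `v`, with coefficients
in a possibly noncommutative ring `S`. -/
abbrev TwoSeries (S : Type*) [Ring S] : Type _ := (S⸨X⸩)⸨X⸩

/-- The first spectral parameter `u`, a unit of `S((u))((v))`. -/
def uVar : (TwoSeries S)ˣ where
  val := HahnSeries.C (HahnSeries.single 1 1)
  inv := HahnSeries.C (HahnSeries.single (-1) 1)
  val_inv := by rw [← map_mul, HahnSeries.single_mul_single]; simp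
  inv_val := by rw [← map_mul, HahnSeries.single_mul_single]; simp

/-- The second spectral parameter `v`, a unit of `S((u))((v))`. -/
def vVar : (TwoSeries S)ˣ where
  val := HahnSeries.single 1 1
  inv := HahnSeries.single (-1) 1
  val_inv := by rw [HahnSeries.single_mul_single]; simp
  inv_val := by rw [HahnSeries.single_mul_single]; simp

/-- `f(u)`: the one-variable series `f`, written in the variable `u`. -/
def atU (f : S⸨X⸩) : TwoSeries S := HahnSeries.C f

/-- `f(v)`: the one-variable series `f`, written in the variable `v`. -/
def atV (f : S⸨X⸩) : TwoSeries S := f.map (HahnSeries.C : S →+* S⸨X⸩)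

/-- The coefficient of `u ^ m * v ^ n`. -/
def coeffUV (f : TwoSeries S) (m n : ℤ) : S := (f.coeff n).coeff m

/-- The series `∑_{n ≥ N} c n u ^ n`. -/
def modeSeries (N : ℤ) (c : Set.Ici N → S) : S⸨X⸩ :=
  HahnSeries.ofSuppBddBelow (fun n => if h : N ≤ n then c ⟨n, h⟩ else 0)
    ⟨N, fun n hn => by
      by_contra h
      exact hn (dif_neg h)⟩

end Series

/-! ### The R-matrix and the reflection equation -/

section Reflection

variable {S : Type*} [Ring S] [Algebra ℂ S]

/-- The `R`-matrix of `U_q(sl₂^)` at an invertible argument `x`; rows and columns are indexed by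
the basis `(0,0), (0,1), (1,0), (1,1)` of `ℂ² ⊗ ℂ²`. -/
def RMatrix (q : ℂ) (x : Sˣ) : Matrix (Fin 2 × Fin 2) (Fin 2 × Fin 2) S :=
  Matrix.of fun r s =>
    if r = s then
      if r.1 = r.2 then q • (x : S) - q⁻¹ • (↑x⁻¹ : S) else (x : S) - (↑x⁻¹ : S)
    else if r = s.swap then algebraMap ℂ S (q - q⁻¹)
    else 0

/-- `R₁₂(u/v) (K(u) ⊗ 1) R₁₂(uv) (1 ⊗ K(v))`. -/
def reflectionLHS (q : ℂ) (K : Matrix (Fin 2) (Fin 2) S⸨X⸩) :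
    Matrix (Fin 2 × Fin 2) (Fin 2 × Fin 2) (TwoSeries S) :=
  RMatrix q (uVar / vVar) * (K.map atU ⊗ₖ 1) * RMatrix q (uVar * vVar) * (1 ⊗ₖ K.map atV)

/-- `(1 ⊗ K(v)) R₁₂(uv) (K(u) ⊗ 1) R₁₂(u/v)`. -/
def reflectionRHS (q : ℂ) (K : Matrix (Fin 2) (Fin 2) S⸨X⸩) :
    Matrix (Fin 2 × Fin 2) (Fin 2 × Fin 2) (TwoSeries S) :=
  (1 ⊗ₖ K.map atV) * RMatrix q (uVar * vVar) * (K.map atU ⊗ₖ 1) * RMatrix q (uVar / vVar)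

/-- `K(u)` solves the reflection ("RKRK") equation. -/
def IsReflectionSolution (q : ℂ) (K : Matrix (Fin 2) (Fin 2) S⸨X⸩) : Prop :=
  reflectionLHS q K = reflectionRHS q K

end Reflection

/-- Generators of the reflection equation algebra: the modes of `A(u)`, `D(u)` (with exponents
`≥ N`) and of `B(u)`, `C(u)` (with exponents `≥ M`). -/
inductive ReflectionGen (N M : ℤ) : Type
  | A (n : Set.Ici N)
  | B (n : Set.Ici M)
  | C (n : Set.Ici M)
  | D (n : Set.Ici N)

/-- `K(u) = (A(u), B(u); C(u), D(u))` with entries over the free algebra. -/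
def freeK (N M : ℤ) : Matrix (Fin 2) (Fin 2) (FreeAlgebra ℂ (ReflectionGen N M))⸨X⸩ :=
  !![modeSeries N fun n => FreeAlgebra.ι ℂ (ReflectionGen.A n),
     modeSeries M fun n => FreeAlgebra.ι ℂ (ReflectionGen.B n);
     modeSeries M fun n => FreeAlgebra.ι ℂ (ReflectionGen.C n),
     modeSeries N fun n => FreeAlgebra.ι ℂ (ReflectionGen.D n)]

/-- Defining relations: every coefficient of every entry of the reflection equation. -/
def ReflectionRel (q : ℂ) (N M : ℤ) (a b : FreeAlgebra ℂ (ReflectionGen N M)) : Prop :=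
  ∃ (r s : Fin 2 × Fin 2) (m n : ℤ),
    a = coeffUV (reflectionLHS q (freeK N M) r s) m n ∧
    b = coeffUV (reflectionRHS q (freeK N M) r s) m n

/-- The reflection equation algebra `B_q(sl₂^)`. -/
abbrev ReflectionAlgebra (q : ℂ) (N M : ℤ) : Type := RingQuot (ReflectionRel q N M)

/-- The generating matrix `K(u)` of `B_q(sl₂^)`. -/
def ReflectionAlgebra.K (q : ℂ) (N M : ℤ) :
    Matrix (Fin 2) (Fin 2) (ReflectionAlgebra q N M)⸨X⸩ :=
  (freeK N M).map fun f => f.map (RingQuot.mkAlgHom ℂ (ReflectionRel q N M))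

/-! ### The current algebra -/

section Current

variable {S : Type*} [Ring S] [Algebra ℂ S]

/-- The `q`-commutator `q x y - q⁻¹ y x`. -/
def qComm (q : ℂ) (x y : S) : S := q • (x * y) - q⁻¹ • (y * x)

/-- `(q x² + q⁻¹ x⁻²) / (q + q⁻¹)`; this is `U` for `x = u` and `V` for `x = v`. -/
def symVar (q : ℂ) (x : Sˣ) : S :=
  (q + q⁻¹)⁻¹ • (q • (x : S) ^ 2 + q⁻¹ • (↑x⁻¹ : S) ^ 2)

/-- The relations `lhs = rhs` between the currents `W s`, `G s`, where `s = true` stands for the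
sign `+`, `s = false` for `-`, and `!s` is the opposite sign. The relation `ww_gg` is multiplied
by `U - V`, which is invertible in `ℂ((u))((v))`. -/
inductive CurrentEq (q ρ : ℂ) (W G : Bool → S⸨X⸩) : TwoSeries S → TwoSeries S → Prop
  | ww (s : Bool) : CurrentEq q ρ W G ⁅atU (W s), atV (W s)⁆ 0
  | ww_symm : CurrentEq q ρ W G
      (⁅atU (W true), atV (W false)⁆ + ⁅atU (W false), atV (W true)⁆) 0
  | ww_mixed (s : Bool) : CurrentEq q ρ W G
      ((symVar q uVar - symVar q vVar) * ⁅atU (W s), atV (W !s)⁆)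
      (((q - q⁻¹) / (ρ * (q + q⁻¹))) •
          (atU (G s) * atV (G !s) - atV (G s) * atU (G !s))
        + (1 / (q + q⁻¹)) •
          (atU (G s) - atU (G !s) + atV (G !s) - atV (G s)))
  | ww_gg (s : Bool) : CurrentEq q ρ W G
      ((symVar q uVar - symVar q vVar) *
          (atU (W s) * atV (W s) - atU (W !s) * atV (W !s)
            + (1 / (ρ * (q ^ 2 - (q⁻¹) ^ 2))) • ⁅atU (G s), atV (G !s)⁆)
        + (1 - symVar q uVar * symVar q vVar) *
          (atU (W s) * atV (W !s) - atV (W s) * atU (W !s))) 0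
  | gw (s : Bool) : CurrentEq q ρ W G
      (symVar q uVar * qComm q (atV (G !s)) (atU (W s))
        - symVar q vVar * qComm q (atU (G !s)) (atV (W s))
        - (q - q⁻¹) • (atU (W !s) * atV (G !s) - atV (W !s) * atU (G !s))
        + ρ • (symVar q uVar * atU (W s) - symVar q vVar * atV (W s)
            - atU (W !s) + atV (W !s))) 0
  | wg (s : Bool) : CurrentEq q ρ W G
      (symVar q uVar * qComm q (atU (W !s)) (atV (G !s))
        - symVar q vVar * qComm q (atV (W !s)) (atU (G !s))
        - (q - q⁻¹) • (atU (W s) * atV (G !s) - atV (W s) * atU (G !s))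
        + ρ • (symVar q uVar * atU (W !s) - symVar q vVar * atV (W !s)
            - atU (W s) + atV (W s))) 0
  | gw_symm (e s : Bool) : CurrentEq q ρ W G
      (⁅atU (G e), atV (W s)⁆ + ⁅atU (W s), atV (G e)⁆) 0
  | gg (s : Bool) : CurrentEq q ρ W G ⁅atU (G s), atV (G s)⁆ 0
  | gg_symm : CurrentEq q ρ W G
      (⁅atU (G true), atV (G false)⁆ + ⁅atU (G false), atV (G true)⁆) 0

/-- The currents `W_±(u)`, `G_±(u)` satisfy all relations of the current algebra. -/
def IsCurrentSolution (q ρ : ℂ) (W G : Bool → S⸨X⸩) : Prop :=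
  ∀ x y, CurrentEq q ρ W G x y → x = y

/-- The matrix `K(u)` built from the currents. -/
def currentMatrix (q kp km : ℂ) (W G : Bool → S⸨X⸩) : Matrix (Fin 2) (Fin 2) S⸨X⸩ :=
  let u : S⸨X⸩ := HahnSeries.single 1 1
  let uinv : S⸨X⸩ := HahnSeries.single (-1) 1
  !![q • (u * W true) - q⁻¹ • (uinv * W false),
     (1 / (km * (q + q⁻¹))) • G true + algebraMap ℂ S⸨X⸩ (kp * (q + q⁻¹) / (q - q⁻¹));
     (1 / (kp * (q + q⁻¹))) • G false + algebraMap ℂ S⸨X⸩ (km * (q + q⁻¹) / (q - q⁻¹)),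
     q • (u * W false) - q⁻¹ • (uinv * W true)]

end Current

/-- Generators of the current algebra: the modes of `W_±(u)` (with exponents `≥ N`) and of
`G_±(u)` (with exponents `≥ M`). -/
inductive CurrentGen (N M : ℤ) : Type
  | W (s : Bool) (n : Set.Ici N)
  | G (s : Bool) (n : Set.Ici M)

/-- `W_±(u)` with coefficients in the free algebra. -/
def freeW (N M : ℤ) (s : Bool) : (FreeAlgebra ℂ (CurrentGen N M))⸨X⸩ :=
  modeSeries N fun n => FreeAlgebra.ι ℂ (CurrentGen.W s n)

/-- `G_±(u)` with coefficients in the free algebra. -/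
def freeG (N M : ℤ) (s : Bool) : (FreeAlgebra ℂ (CurrentGen N M))⸨X⸩ :=
  modeSeries M fun n => FreeAlgebra.ι ℂ (CurrentGen.G s n)

/-- Defining relations: every coefficient of every relation between the currents. -/
def CurrentRel (q ρ : ℂ) (N M : ℤ) (a b : FreeAlgebra ℂ (CurrentGen N M)) : Prop :=
  ∃ x y, CurrentEq q ρ (freeW N M) (freeG N M) x y ∧
    ∃ m n : ℤ, a = coeffUV x m n ∧ b = coeffUV y m n

/-- The current algebra `O_q(sl₂^)` with parameter `ρ`. -/
abbrev CurrentAlgebra (q ρ : ℂ) (N M : ℤ) : Type := RingQuot (CurrentRel q ρ N M)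

/-- The generating currents `W_±(u)` of `O_q(sl₂^)`. -/
def CurrentAlgebra.W (q ρ : ℂ) (N M : ℤ) (s : Bool) : (CurrentAlgebra q ρ N M)⸨X⸩ :=
  (freeW N M s).map (RingQuot.mkAlgHom ℂ (CurrentRel q ρ N M))

/-- The generating currents `G_±(u)` of `O_q(sl₂^)`. -/
def CurrentAlgebra.G (q ρ : ℂ) (N M : ℤ) (s : Bool) : (CurrentAlgebra q ρ N M)⸨X⸩ :=
  (freeG N M s).map (RingQuot.mkAlgHom ℂ (CurrentRel q ρ N M))

/-- The algebra homomorphism `Φ` sends `A(u), B(u), C(u), D(u)`, coefficient by coefficient, to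
the entries of the matrix built from the currents. -/
def IsPhi (q kp km : ℂ) {ρ : ℂ} {N M N' M' : ℤ}
    (Φ : ReflectionAlgebra q N M →ₐ[ℂ] CurrentAlgebra q ρ N' M') : Prop :=
  ∀ i j, (ReflectionAlgebra.K q N M i j).map Φ =
    currentMatrix q kp km (CurrentAlgebra.W q ρ N' M') (CurrentAlgebra.G q ρ N' M') i j

end ReflectionCurrent

end

/-!
The current relations are the reflection equation, rewritten entry by entry. The shift of `G_±` by
constants in `B`, `C` makes the relations homogeneous: in terms of `W_±`, `B`, `C` all of them are
quadratic, and the terms of degree one in the current relations are the cross terms of the shift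
(`shifted_iff`). Both families are compatible with the weight of matrix entries, so they split
into a block of weight zero, two blocks of weight `±1` which are the same up to exchanging `A`
with `D` and `B` with `C`, and the two equations `[B(u), B(v)] = 0`, `[C(u), C(v)] = 0`
(`reflection_iff`).

Within one block, both families are systems of linear equations between products of two currents,
with coefficients in the field `ℂ((u))((v))`, which acts on `S((u))((v))` by central elements. The
equivalence of two such systems is proved by elimination: one family, solved for some of the
products, expresses everything through the remaining ones, after which the other family becomes a
list of identities between rational functions of `q`, `u`, `v` (`offDiag_iff`, `diag_iff`). The
denominators are differences of non-proportional monomials in `u` and `v`, or polynomials in `q`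
whose zeros are roots of unity, hence invertible (`spectralScalars`). This gives the equivalence
over every coefficient algebra (`reflection_iff_current`).

For the isomorphism, the passage `currentMatrix` from currents to matrices is inverted explicitly:
the matrix that takes `W_±` to `A`, `D` has determinant `q² u² - q⁻² u⁻²`, and the inverse of
`1 - q⁴ u⁴` is a geometric series (`currentW`, `currentG`). If `A`, `D` start at `u ^ N` then `W_±`
start at `u ^ (N + 1)` and conversely, and `M ≤ 0` makes room for the constants in `B` and `C`. Both
algebras represent the functor of solutions with prescribed orders (`exists_lift`, `algHom_ext`),
functoriality being the fact that a homomorphism can be applied coefficient by coefficient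
(`isReflectionSolution_map_iff`, `isCurrentSolution_map_iff`). Mutually inverse natural
transformations then give mutually inverse homomorphisms.
-/

noncomputable section

namespace ReflectionCurrent

/-! ### Laurent series: change of coefficients and central scalars -/

section Laurent

variable {S S' : Type*} [Ring S] [Ring S']

/-- Application of a ring homomorphism to all coefficients of a Laurent series. -/
def laurentMap (φ : S →+* S') : S⸨X⸩ →+* S'⸨X⸩ where
  toFun f := f.map φ
  map_zero' := HahnSeries.map_zero (φ : ZeroHom S S')
  map_one' := HahnSeries.map_one (φ.toMonoidWithZeroHom)
  map_add' _ _ := HahnSeries.map_add (φ : S →+ S')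
  map_mul' _ _ := HahnSeries.map_mul (φ : S →ₙ+* S')

@[simp]
lemma coeff_laurentMap (φ : S →+* S') (f : S⸨X⸩) (n : ℤ) :
    (laurentMap φ f).coeff n = φ (f.coeff n) := rfl

@[simp]
lemma laurentMap_single (φ : S →+* S') (n : ℤ) (s : S) :
    laurentMap φ (HahnSeries.single n s) = HahnSeries.single n (φ s) :=
  HahnSeries.map_single (φ : ZeroHom S S')

@[simp]
lemma laurentMap_C (φ : S →+* S') (s : S) :
    laurentMap φ (HahnSeries.C s) = HahnSeries.C (φ s) := laurentMap_single φ 0 s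

/-- Laurent series with central coefficients are central. -/
lemma laurentMap_commute {φ : S →+* S'} (h : ∀ r s, φ r * s = s * φ r) (f : S⸨X⸩) (g : S'⸨X⸩) :
    laurentMap φ f * g = g * laurentMap φ f := by
  ext n
  rw [HahnSeries.coeff_mul, HahnSeries.coeff_mul]
  refine Finset.sum_equiv (Equiv.prodComm ℤ ℤ) (fun i => ?_) (fun i _ => ?_)
  · simp only [Finset.mem_antidiagonal, Equiv.prodComm_apply, Prod.fst_swap, Prod.snd_swap,
      add_comm i.1]
    tauto
  · exact h (f.coeff i.1) (g.coeff i.2)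

lemma twoSeries_ext {f g : TwoSeries S} (h : ∀ m n, coeffUV f m n = coeffUV g m n) : f = g := by
  ext n m
  exact h m n

end Laurent

/-! ### The reflection equation and the current relations over a field of scalars -/

section Blocks

variable {F T : Type*} [Field F] [Ring T] [Algebra F T]

/-- The scalars of the reflection equation: `a`, `b`, `c` are the entries of `R(u/v)`, `a'`, `b'`,
`c` those of `R(uv)`, and `U`, `V` the symmetrised spectral parameters. The Greek letters name the
polynomials in `q`, `u`, `v` that occur as denominators when one passes between the two families
of relations; genericity of `q`, `u`, `v` means exactly that none of them vanishes. -/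
structure SpectralScalars (q u v s σ α β α' β' δ δ' η θ a b c a' b' U V : F) : Prop where
  hq : q ≠ 0
  hu : u ≠ 0
  hv : v ≠ 0
  hs : s ≠ 0
  hσ : σ ≠ 0
  hα : α ≠ 0
  hβ : β ≠ 0
  hα' : α' ≠ 0
  hβ' : β' ≠ 0
  hδ : δ ≠ 0
  hδ' : δ' ≠ 0
  hη : η ≠ 0
  hθ : θ ≠ 0
  es : s = q ^ 2 + 1
  eσ : σ = q ^ 2 - 1
  eα : α = q ^ 2 * u ^ 2 - v ^ 2
  eβ : β = u ^ 2 - v ^ 2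
  eα' : α' = q ^ 2 * u ^ 2 * v ^ 2 - 1
  eβ' : β' = u ^ 2 * v ^ 2 - 1
  eδ : δ = q ^ 4 * u ^ 4 - 1
  eδ' : δ' = q ^ 4 * v ^ 4 - 1
  eη : η = u ^ 2 - q ^ 2 * v ^ 2
  eθ : θ = q ^ 4 * u ^ 2 * v ^ 2 - 1
  ea : a = α / (q * u * v)
  eb : b = β / (u * v)
  ea' : a' = α' / (q * u * v)
  eb' : b' = β' / (u * v)
  ec : c = σ / q
  eU : U = (q ^ 2 * u ^ 4 + 1) / (s * u ^ 2)
  eV : V = (q ^ 2 * v ^ 4 + 1) / (s * v ^ 2)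

/-- The entries of the reflection equation that exchange `A`, `D` with `B`: they occur once for
`B`, and once more for `C` with the roles of `A` and `D` interchanged. -/
def OffDiagReflection (a b c a' b' : F) (A A' D D' B B' : T) : Prop :=
  a • (a' • (A * B') + c • (B * D')) = (b * b') • (B' * A) + c • (a' • (A' * B) + c • (B' * D)) ∧
  (a * b') • (B * A') = (c * b') • (B' * A) + b • (a' • (A' * B) + c • (B' * D)) ∧
  b • (c • (A * B') + a' • (B * D')) + (c * b') • (D * B') = (a * b') • (D' * B) ∧
  c • (c • (A * B') + a' • (B * D')) + (b * b') • (D * B') = a • (c • (A' * B) + a' • (B' * D))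

/-- The current relations between `W_±` and one of the shifted currents `B`, `C`. The shift by a
constant has absorbed the terms of degree one. -/
def OffDiagCurrent (q c U V : F) (p p' m m' B B' : T) : Prop :=
  U • (q • (B' * m) - q⁻¹ • (m * B')) - V • (q • (B * m') - q⁻¹ • (m' * B))
    - c • (p * B' - p' * B) = 0 ∧
  U • (q • (p * B') - q⁻¹ • (B' * p)) - V • (q • (p' * B) - q⁻¹ • (B * p'))
    - c • (m * B' - m' * B) = 0 ∧
  (B * p' - p' * B) + (p * B' - B' * p) = 0 ∧
  (B * m' - m' * B) + (m * B' - B' * m) = 0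

/-- The entries of the reflection equation that preserve the weight. -/
def DiagReflection (a b c a' b' : F) (A A' D D' B B' C C' : T) : Prop :=
  a • (a' • (A * A') + c • (B * C')) = a • (a' • (A' * A) + c • (B' * C)) ∧
  a • (a' • (D * D') + c • (C * B')) = a • (a' • (D' * D) + c • (C' * B)) ∧
  (b * b') • (A * D') + c • (a' • (C * B') + c • (D * D'))
    = (b * b') • (D' * A) + c • (a' • (C' * B) + c • (D' * D)) ∧
  (b * b') • (D * A') + c • (a' • (B * C') + c • (A * A'))
    = (b * b') • (A' * D) + c • (a' • (B' * C) + c • (A' * A)) ∧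
  b • (a' • (B * C') + c • (A * A')) + (c * b') • (D * A')
    = b • (a' • (C' * B) + c • (D' * D)) + (c * b') • (D' * A) ∧
  b • (a' • (C * B') + c • (D * D')) + (c * b') • (A * D')
    = b • (a' • (B' * C) + c • (A' * A)) + (c * b') • (A' * D)

/-- The current relations of weight zero, between `W_±` and both shifted currents `B`, `C`. -/
def DiagCurrent (q s σ U V : F) (p p' m m' B B' C C' : T) : Prop :=
  (p * p' - p' * p = 0 ∧ m * m' - m' * m = 0) ∧
  (p * m' - m' * p) + (m * p' - p' * m) = 0 ∧
  ((U - V) • (p * m' - m' * p) = (σ / s) • (B * C' - B' * C) ∧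
    (U - V) • (m * p' - p' * m) = (σ / s) • (C * B' - C' * B)) ∧
  ((U - V) • (p * p' - m * m' + (q ^ 2 / (σ * s)) • (B * C' - C' * B))
      + (1 - U * V) • (p * m' - p' * m) = 0 ∧
    (U - V) • (m * m' - p * p' + (q ^ 2 / (σ * s)) • (C * B' - B' * C))
      + (1 - U * V) • (m * p' - m' * p) = 0) ∧
  (B * C' - C' * B) + (C * B' - B' * C) = 0

lemma eq_inv_smul_of_smul_eq {k : F} (hk : k ≠ 0) {x y : T} (h : k • x = y) : x = k⁻¹ • y :=
  (eq_inv_smul_iff₀ hk).2 h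

variable {q u v s σ α β α' β' δ δ' η θ a b c a' b' U V : F}
  {A A' D D' B B' C C' p p' m m' : T}

set_option maxHeartbeats 4000000 in
/-- For `A`, `D` built from `W_± = p, m`, the four entries of the reflection equation for one
off-diagonal block are equivalent to the four current relations for that block. In both
directions one family is triangular with respect to the products that it relates, so that it
rewrites all of them in terms of four words; the other family then holds word by word. -/
lemma offDiag_iff
    (h : SpectralScalars q u v s σ α β α' β' δ δ' η θ a b c a' b' U V)
    (eA : A = (u * q) • p - (u * q)⁻¹ • m) (eA' : A' = (v * q) • p' - (v * q)⁻¹ • m')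
    (eD : D = (u * q) • m - (u * q)⁻¹ • p) (eD' : D' = (v * q) • m' - (v * q)⁻¹ • p') :
    OffDiagReflection a b c a' b' A A' D D' B B' ↔ OffDiagCurrent q c U V p p' m m' B B' := by
  unfold OffDiagReflection OffDiagCurrent
  obtain ⟨hq, hu, hv, hs, hσ, hα, hβ, hα', hβ', hδ, hδ', hη, hθ, es, eσ, eα, eβ, eα', eβ', eδ,
    eδ', eη, eθ, ea, eb, ea', eb', ec, eU, eV⟩ := h
  have hUV : U - V = β * α' / (s * u ^ 2 * v ^ 2) := by
    rw [eU, eV]; field_simp; rw [eβ, eα']; ring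
  constructor
  · rintro ⟨h1, h2, h3, h4⟩
    have na : a ≠ 0 := by rw [ea]; positivity
    have nb : b ≠ 0 := by rw [eb]; positivity
    have na' : a' ≠ 0 := by rw [ea']; positivity
    have nb' : b' ≠ 0 := by rw [eb']; positivity
    -- The passage from `W_±` to `A`, `D` is invertible, with determinant `δ / (u * q) ^ 2`.
    have ep : p = ((u * q) ^ 2 / δ) • ((u * q) • A + (u * q)⁻¹ • D) := by
      rw [eA, eD]
      match_scalars <;> field_simp <;> rw [eδ] <;> ring
    have em : m = ((u * q) ^ 2 / δ) • ((u * q) • D + (u * q)⁻¹ • A) := by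
      rw [eA, eD]
      match_scalars <;> field_simp <;> rw [eδ] <;> ring
    have ep' : p' = ((v * q) ^ 2 / δ') • ((v * q) • A' + (v * q)⁻¹ • D') := by
      rw [eA', eD']
      match_scalars <;> field_simp <;> rw [eδ'] <;> ring
    have em' : m' = ((v * q) ^ 2 / δ') • ((v * q) • D' + (v * q)⁻¹ • A') := by
      rw [eA', eD']
      match_scalars <;> field_simp <;> rw [eδ'] <;> ring
    clear eA eA' eD eD'
    -- Solving for `B * D'`, `B' * D`, `B' * A`, `B * A'` in this order leaves the words with
    -- `B` or `B'` on the right.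
    have e1 : B * D' = (b * a')⁻¹ • ((a * b') • (D' * B) - (c * b') • (D * B')
        - (b * c) • (A * B')) := by
      refine eq_inv_smul_of_smul_eq (mul_ne_zero nb na') ?_
      rw [← h3]; module
    have e2 : B' * D = (a * a')⁻¹ • ((c ^ 2) • (A * B') + (c * a') • (B * D')
        + (b * b') • (D * B') - (a * c) • (A' * B)) := by
      refine eq_inv_smul_of_smul_eq (mul_ne_zero na na') ?_
      have : (c ^ 2) • (A * B') + (c * a') • (B * D') + (b * b') • (D * B') =
        a • (c • (A' * B) + a' • (B' * D)) := by rw [← h4]; module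
      rw [this]; module
    have e3 : B' * A = (b * b')⁻¹ • (a • (a' • (A * B') + c • (B * D'))
        - c • (a' • (A' * B) + c • (B' * D))) := by
      refine eq_inv_smul_of_smul_eq (mul_ne_zero nb nb') ?_
      rw [h1]; module
    have e4 : B * A' = (a * b')⁻¹ • ((c * b') • (B' * A)
        + b • (a' • (A' * B) + c • (B' * D))) :=
      eq_inv_smul_of_smul_eq (mul_ne_zero na nb') h2
    rw [e1] at e2 e3
    rw [e2] at e3 e4
    rw [e3] at e4
    clear h1 h2 h3 h4
    subst ea eb ea' eb' ec eU eV
    subst p m p' m'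
    simp only [mul_add, add_mul, smul_mul_assoc, mul_smul_comm, e1, e2, e3, e4]
    refine ⟨?_, ?_, ?_, ?_⟩
    · match_scalars <;> field_simp <;> simp only [es, eσ, eα, eβ, eα', eβ', eδ, eδ'] <;> ring
    · match_scalars <;> field_simp <;> simp only [es, eσ, eα, eβ, eα', eβ', eδ, eδ'] <;> ring
    · match_scalars <;> field_simp <;> simp only [es, eσ, eα, eβ, eα', eβ', eδ, eδ'] <;> ring
    · match_scalars <;> field_simp <;> simp only [es, eσ, eα, eβ, eα', eβ', eδ, eδ'] <;> ring
  · rintro ⟨h1, h2, h3, h4⟩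
    have nUV : q * (U - V) ≠ 0 := by
      rw [hUV]; positivity
    -- The two symmetric relations give `B * p'` and `B * m'`; after that the other two give
    -- `B' * m` and `B' * p`, with the denominator `q * (U - V)`.
    have e1 : B * p' = p' * B - p * B' + B' * p := by
      rw [← sub_eq_zero, ← h3]; abel
    have e2 : B * m' = m' * B - m * B' + B' * m := by
      rw [← sub_eq_zero, ← h4]; abel
    have e3 : B' * m = (q * (U - V))⁻¹ • (-(q * V - U * q⁻¹) • (m * B')
        + (c * V) • (m' * B) + c • (p * B' - p' * B)) := by
      rw [eq_inv_smul_iff₀ nUV, ← sub_eq_zero, ← h1, e2]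
      rw [ec, eσ]
      match_scalars <;> field_simp <;> ring
    have e4 : B' * p = (q * (U - V))⁻¹ • ((q ^ 2 * (q * U - V * q⁻¹)) • (p * B')
        - (q ^ 2 * c * V) • (p' * B) - (q ^ 2 * c) • (m * B' - m' * B)) := by
      rw [eq_inv_smul_iff₀ nUV, ← sub_eq_zero, ← smul_zero (-q ^ 2), ← h2, e1]
      rw [ec, eσ]
      match_scalars <;> field_simp <;> ring
    subst eA eA' eD eD'
    rw [hUV] at e3 e4
    subst ea eb ea' eb' ec eU eV
    simp only [mul_sub, sub_mul, smul_mul_assoc, mul_smul_comm, e1, e2, e3, e4]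
    clear h1 h2 h3 h4 e1 e2 e3 e4 hUV nUV
    refine ⟨?_, ?_, ?_, ?_⟩
    · match_scalars <;> field_simp <;> simp only [es, eσ, eα, eβ, eα', eβ'] <;> ring
    · match_scalars <;> field_simp <;> simp only [es, eσ, eα, eβ, eα', eβ'] <;> ring
    · match_scalars <;> field_simp <;> simp only [es, eσ, eα, eβ, eα', eβ'] <;> ring
    · match_scalars <;> field_simp <;> simp only [es, eσ, eα, eβ, eα', eβ'] <;> ring

set_option maxHeartbeats 4000000 in
/-- For `A`, `D` built from `W_± = p, m`, the six entries of the reflection equation that preserve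
the weight are equivalent to the current relations of weight zero; the method is that of
`offDiag_iff`, with six words left after the elimination. -/
lemma diag_iff
    (h : SpectralScalars q u v s σ α β α' β' δ δ' η θ a b c a' b' U V)
    (eA : A = (u * q) • p - (u * q)⁻¹ • m) (eA' : A' = (v * q) • p' - (v * q)⁻¹ • m')
    (eD : D = (u * q) • m - (u * q)⁻¹ • p) (eD' : D' = (v * q) • m' - (v * q)⁻¹ • p') :
    DiagReflection a b c a' b' A A' D D' B B' C C' ↔
      DiagCurrent q s σ U V p p' m m' B B' C C' := by
  unfold DiagReflection DiagCurrent
  obtain ⟨hq, hu, hv, hs, hσ, hα, hβ, hα', hβ', hδ, hδ', hη, hθ, es, eσ, eα, eβ, eα', eβ', eδ,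
    eδ', eη, eθ, ea, eb, ea', eb', ec, eU, eV⟩ := h
  have hUV : U - V = β * α' / (s * u ^ 2 * v ^ 2) := by
    rw [eU, eV]; field_simp; rw [eβ, eα']; ring
  constructor
  · rintro ⟨h1, h2, h3, h4, h5, h6⟩
    have na : a ≠ 0 := by rw [ea]; positivity
    have nb : b ≠ 0 := by rw [eb]; positivity
    have na' : a' ≠ 0 := by rw [ea']; positivity
    have nb' : b' ≠ 0 := by rw [eb']; positivity
    have nc : c ≠ 0 := by rw [ec]; positivity
    -- The passage from `W_±` to `A`, `D` is invertible, with determinant `δ / (u * q) ^ 2`.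
    have ep : p = ((u * q) ^ 2 / δ) • ((u * q) • A + (u * q)⁻¹ • D) := by
      rw [eA, eD]
      match_scalars <;> field_simp <;> rw [eδ] <;> ring
    have em : m = ((u * q) ^ 2 / δ) • ((u * q) • D + (u * q)⁻¹ • A) := by
      rw [eA, eD]
      match_scalars <;> field_simp <;> rw [eδ] <;> ring
    have ep' : p' = ((v * q) ^ 2 / δ') • ((v * q) • A' + (v * q)⁻¹ • D') := by
      rw [eA', eD']
      match_scalars <;> field_simp <;> rw [eδ'] <;> ring
    have em' : m' = ((v * q) ^ 2 / δ') • ((v * q) • D' + (v * q)⁻¹ • A') := by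
      rw [eA', eD']
      match_scalars <;> field_simp <;> rw [eδ'] <;> ring
    clear eA eA' eD eD'
    -- `t` is `q² u v - q⁻² u⁻¹ v⁻¹`, the factor besides `b'` of `a' ^ 2 - c ^ 2`.
    obtain ⟨t, et⟩ : ∃ t, t = θ / (q ^ 2 * u * v) := ⟨_, rfl⟩
    have nt : t ≠ 0 := by rw [et]; positivity
    have key : a' ^ 2 - c ^ 2 = b' * t := by
      rw [ea', ec, eb', et]; field_simp; simp only [eα', eσ, eβ', eθ]; ring
    have key2 : c ^ 2 - b ^ 2 = - (α * η / (q * u * v) ^ 2) := by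
      rw [ec, eb]; field_simp; simp only [eσ, eβ, eα, eη]; ring
    have h1' := smul_right_injective T na h1
    have h2' := smul_right_injective T na h2
    -- All words in which the primed factor comes first are eliminated.
    have e1 : B' * C = c⁻¹ • (c • (B * C') + a' • (A * A') - a' • (A' * A)) := by
      refine eq_inv_smul_of_smul_eq nc ?_
      rw [← sub_eq_zero] at h1' ⊢; rw [← neg_eq_zero, ← h1']; module
    have e2 : C' * B = c⁻¹ • (c • (C * B') + a' • (D * D') - a' • (D' * D)) := by
      refine eq_inv_smul_of_smul_eq nc ?_
      rw [← sub_eq_zero] at h2' ⊢; rw [← neg_eq_zero, ← h2']; module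
    have e3 : D' * A = A * D' - (t / b) • (D * D' - D' * D) := by
      have : (b * b') • (D' * A) = (b * b') • (A * D') - (b' * t) • (D * D' - D' * D) := by
        rw [e2] at h3
        rw [← sub_eq_zero] at h3 ⊢; rw [← neg_eq_zero, ← h3, ← key]
        match_scalars <;> field_simp <;> ring
      refine smul_right_injective T (mul_ne_zero nb nb') (this.trans ?_)
      match_scalars <;> field_simp
    have e4 : A' * D = D * A' - (t / b) • (A * A' - A' * A) := by
      have : (b * b') • (A' * D) = (b * b') • (D * A') - (b' * t) • (A * A' - A' * A) := by
        rw [e1] at h4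
        rw [← sub_eq_zero] at h4 ⊢; rw [← neg_eq_zero, ← h4, ← key]
        match_scalars <;> field_simp <;> ring
      refine smul_right_injective T (mul_ne_zero nb nb') (this.trans ?_)
      match_scalars <;> field_simp
    -- `k` is the coefficient of `D' * D` once `e2` and `e3` are inserted into `h5`.
    obtain ⟨k, ek⟩ : ∃ k, k = b' * t * (c ^ 2 - b ^ 2) / (b * c) := ⟨_, rfl⟩
    have nk : k ≠ 0 := by
      have := neg_ne_zero.2 (show α * η / (q * u * v) ^ 2 ≠ 0 by positivity)
      rw [ek, key2]
      positivity
    have ek' : b * a' ^ 2 / c - c * b' * t / b = b * c - k := by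
      rw [ek]; field_simp; linear_combination b ^ 2 * key
    have e5 : D' * D = D * D' + k⁻¹ • ((b * a') • (B * C' - C * B') + (b * c) • (A * A' - D * D')
        + (c * b') • (D * A' - A * D')) := by
      rw [← sub_eq_iff_eq_add']
      refine eq_inv_smul_of_smul_eq nk ?_
      rw [e2, e3] at h5
      have ek2 : k = b * c - (b * a' ^ 2 / c - c * b' * t / b) := by rw [ek']; ring
      rw [← sub_eq_zero] at h5 ⊢; rw [← neg_eq_zero, ← h5, ek2]
      match_scalars <;> field_simp <;> ring
    have e6 : A' * A = A * A' + k⁻¹ • ((b * a') • (C * B' - B * C') + (b * c) • (D * D' - A * A')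
        + (c * b') • (A * D' - D * A')) := by
      rw [← sub_eq_iff_eq_add']
      refine eq_inv_smul_of_smul_eq nk ?_
      rw [e1, e4] at h6
      have ek2 : k = b * c - (b * a' ^ 2 / c - c * b' * t / b) := by rw [ek']; ring
      rw [← sub_eq_zero] at h6 ⊢; rw [← neg_eq_zero, ← h6, ek2]
      match_scalars <;> field_simp <;> ring
    rw [e6] at e1 e4
    rw [e5] at e2 e3
    rw [key2] at ek
    clear h1 h2 h3 h4 h5 h6 h1' h2' ek' key key2 na na' nb nb' nc nt nk
    subst ek et ea eb ea' eb' ec eU eV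
    subst p m p' m'
    simp only [mul_add, add_mul, smul_mul_assoc, mul_smul_comm, e1, e2, e3, e4, e5, e6]
    clear e1 e2 e3 e4 e5 e6
    refine ⟨⟨?_, ?_⟩, ?_, ⟨?_, ?_⟩, ⟨?_, ?_⟩, ?_⟩
    all_goals
      match_scalars <;> field_simp <;>
        simp only [es, eσ, eα, eβ, eα', eβ', eδ, eδ', eη, eθ] <;> ring
  · -- Only one of the two relations containing `1 - U * V` is needed: the other one, and the
    -- last relation, are consequences of the rest.
    rintro ⟨⟨h1, h2⟩, h3, ⟨h4, h5⟩, ⟨h6, -⟩, -⟩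
    have nUV : U - V ≠ 0 := by
      rw [hUV]; positivity
    have nσs : σ / s ≠ 0 := by positivity
    have e1 : p' * p = p * p' := by rw [← sub_eq_zero, ← neg_eq_zero, ← h1]; abel
    have e2 : m' * m = m * m' := by rw [← sub_eq_zero, ← neg_eq_zero, ← h2]; abel
    have e3 : p' * m = m * p' + (p * m' - m' * p) := by
      rw [← sub_eq_zero, ← neg_eq_zero, ← h3]; abel
    have e4 : B' * C = B * C' - (s / σ * (U - V)) • (p * m' - m' * p) := by
      rw [mul_smul, h4]; match_scalars <;> field_simp <;> ring
    have e5 : C' * B = C * B' + (s / σ * (U - V)) • (p * m' - m' * p) := by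
      have : (p * m' - m' * p) = - (m * p' - p' * m) := by
        rw [← sub_eq_zero, ← h3]; abel
      rw [this, mul_smul, smul_neg, h5]; match_scalars <;> field_simp <;> ring
    have e6 : C * B' = B * C' - (s / σ * (U - V)) • (p * m' - m' * p)
        + (σ * s / q ^ 2) • (p * p' - m * m')
        + (σ * s / q ^ 2 * (1 - U * V) / (U - V)) • (p * m' - p' * m) := by
      have nk : q ^ 2 / (σ * s) * (U - V) ≠ 0 := by positivity
      refine smul_right_injective T nk ?_
      dsimp only
      rw [e5] at h6
      rw [← sub_eq_zero, ← neg_eq_zero, ← h6]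
      generalize U - V = w at *
      match_scalars <;> field_simp
    rw [e6] at e5
    rw [e3] at e5 e6
    clear h1 h2 h3 h4 h5 h6
    rw [hUV] at e4 e5 e6
    subst eA eA' eD eD'
    subst ea eb ea' eb' ec eU eV
    simp only [mul_sub, sub_mul, smul_mul_assoc, mul_smul_comm, e1, e2, e3, e4, e5, e6]
    clear e1 e2 e3 e4 e5 e6 hUV nUV
    refine ⟨?_, ?_, ?_, ?_, ?_, ?_⟩
    all_goals
      match_scalars <;> field_simp <;>
        simp only [es, eσ, eα, eβ, eα', eβ'] <;> ring

end Blocks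

/-! ### Expansion of the two families of relations -/

section Reflection

variable {F T : Type*} [Field F] [Ring T] [Algebra F T] [Algebra ℂ T]

/-- The sixteen entries of the reflection equation, grouped by weight: six preserve the weight,
four shift it by one in either direction, and one shifts it by two in either direction. -/
lemma reflection_iff {q : ℂ} {x y : Tˣ} {a b c a' b' : F}
    (ea : q • (x : T) - q⁻¹ • (↑x⁻¹ : T) = algebraMap F T a)
    (eb : (x : T) - (↑x⁻¹ : T) = algebraMap F T b)
    (ea' : q • (y : T) - q⁻¹ • (↑y⁻¹ : T) = algebraMap F T a')
    (eb' : (y : T) - (↑y⁻¹ : T) = algebraMap F T b')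
    (ec : algebraMap ℂ T (q - q⁻¹) = algebraMap F T c)
    {K K' : Matrix (Fin 2) (Fin 2) T} {A A' B B' C C' D D' : T}
    (hK : K = !![A, B; C, D]) (hK' : K' = !![A', B'; C', D']) :
    RMatrix q x * (K ⊗ₖ 1) * RMatrix q y * (1 ⊗ₖ K') =
      (1 ⊗ₖ K') * RMatrix q y * (K ⊗ₖ 1) * RMatrix q x ↔
    DiagReflection a b c a' b' A A' D D' B B' C C' ∧
      OffDiagReflection a b c a' b' A A' D D' B B' ∧
      OffDiagReflection a b c a' b' D D' A A' C C' ∧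
      (a * b') • (B * B' - B' * B) = 0 ∧ (a * b') • (C * C' - C' * C) = 0 := by
  have hcomm : ∀ (r : F) (X : T), X * algebraMap F T r = r • X := fun r X => by
    rw [← Algebra.commutes, ← Algebra.smul_def]
  have e00 : K 0 0 = A := by rw [hK]; rfl
  have e01 : K 0 1 = B := by rw [hK]; rfl
  have e10 : K 1 0 = C := by rw [hK]; rfl
  have e11 : K 1 1 = D := by rw [hK]; rfl
  have e00' : K' 0 0 = A' := by rw [hK']; rfl
  have e01' : K' 0 1 = B' := by rw [hK']; rfl
  have e10' : K' 1 0 = C' := by rw [hK']; rfl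
  have e11' : K' 1 1 = D' := by rw [hK']; rfl
  clear hK hK'
  rw [mul_assoc, mul_assoc, ← Matrix.ext_iff]
  simp only [Prod.forall, Fin.forall_fin_two, Matrix.mul_apply, Fintype.sum_prod_type,
    Fin.sum_univ_two, RMatrix, Matrix.kroneckerMap_apply, Matrix.one_apply, Matrix.of_apply,
    ea, eb, ea', eb', ec, e00, e01, e10, e11, e00', e01', e10', e11']
  simp only [DiagReflection, OffDiagReflection, smul_sub, sub_eq_zero]
  simp [-smul_add, Prod.ext_iff, ← Algebra.smul_def, hcomm]
  constructor
  · rintro ⟨⟨⟨⟨h1, h2⟩, h3, h4⟩, ⟨h5, h6⟩, h7, h8⟩, ⟨⟨h9, h10⟩, h11, h12⟩, ⟨h13, h14⟩, h15, h16⟩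
    refine ⟨⟨h1, ?_, ?_, ?_, ?_, ?_⟩, ⟨?_, ?_, ?_, ?_⟩, ⟨?_, ?_, ?_, ?_⟩, ?_, ?_⟩
    · convert h16 using 1 <;> module
    · convert h6 using 1 <;> module
    · convert h11 using 1 <;> module
    · convert h7 using 1 <;> module
    · convert h10 using 1 <;> module
    · convert h2 using 1 <;> module
    · convert h3 using 1 <;> module
    · convert h8 using 1 <;> module
    · convert h12 using 1 <;> module
    · convert h15 using 1 <;> module
    · convert h14 using 1 <;> module
    · convert h9 using 1 <;> module
    · convert h5 using 1 <;> module
    · convert h4 using 1 <;> module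
    · convert h13 using 1 <;> module
  · rintro ⟨⟨h1, h16, h6, h11, h7, h10⟩, ⟨h2, h3, h8, h12⟩, ⟨h15, h14, h9, h5⟩, h4, h13⟩
    refine ⟨⟨⟨⟨h1, ?_⟩, ?_, ?_⟩, ⟨?_, ?_⟩, ?_, ?_⟩, ⟨⟨?_, ?_⟩, ?_, ?_⟩, ⟨?_, ?_⟩, ?_, ?_⟩
    · convert h2 using 1 <;> module
    · convert h3 using 1 <;> module
    · convert h4 using 1 <;> module
    · convert h5 using 1 <;> module
    · convert h6 using 1 <;> module
    · convert h7 using 1 <;> module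
    · convert h8 using 1 <;> module
    · convert h9 using 1 <;> module
    · convert h10 using 1 <;> module
    · convert h11 using 1 <;> module
    · convert h12 using 1 <;> module
    · convert h13 using 1 <;> module
    · convert h14 using 1 <;> module
    · convert h15 using 1 <;> module
    · convert h16 using 1 <;> module

end Reflection

section CurrentRelations

variable {S : Type*} [Ring S] [Algebra ℂ S]

/-- The relations `CurrentEq` as a conjunction. -/
lemma isCurrentSolution_iff {q ρ : ℂ} {W G : Bool → S⸨X⸩} :
    IsCurrentSolution q ρ W G ↔
    (∀ s, ⁅atU (W s), atV (W s)⁆ = 0) ∧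
    ⁅atU (W true), atV (W false)⁆ + ⁅atU (W false), atV (W true)⁆ = 0 ∧
    (∀ s, (symVar q uVar - symVar q vVar) * ⁅atU (W s), atV (W !s)⁆ =
      ((q - q⁻¹) / (ρ * (q + q⁻¹))) •
          (atU (G s) * atV (G !s) - atV (G s) * atU (G !s))
        + (1 / (q + q⁻¹)) •
          (atU (G s) - atU (G !s) + atV (G !s) - atV (G s))) ∧
    (∀ s, (symVar q uVar - symVar q vVar) *
          (atU (W s) * atV (W s) - atU (W !s) * atV (W !s)
            + (1 / (ρ * (q ^ 2 - (q⁻¹) ^ 2))) • ⁅atU (G s), atV (G !s)⁆)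
        + (1 - symVar q uVar * symVar q vVar) *
          (atU (W s) * atV (W !s) - atV (W s) * atU (W !s)) = 0) ∧
    (∀ s, symVar q uVar * qComm q (atV (G !s)) (atU (W s))
        - symVar q vVar * qComm q (atU (G !s)) (atV (W s))
        - (q - q⁻¹) • (atU (W !s) * atV (G !s) - atV (W !s) * atU (G !s))
        + ρ • (symVar q uVar * atU (W s) - symVar q vVar * atV (W s)
            - atU (W !s) + atV (W !s)) = 0) ∧
    (∀ s, symVar q uVar * qComm q (atU (W !s)) (atV (G !s))
        - symVar q vVar * qComm q (atV (W !s)) (atU (G !s))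
        - (q - q⁻¹) • (atU (W s) * atV (G !s) - atV (W s) * atU (G !s))
        + ρ • (symVar q uVar * atU (W !s) - symVar q vVar * atV (W !s)
            - atU (W s) + atV (W s)) = 0) ∧
    (∀ e s, ⁅atU (G e), atV (W s)⁆ + ⁅atU (W s), atV (G e)⁆ = 0) ∧
    (∀ s, ⁅atU (G s), atV (G s)⁆ = 0) ∧
    ⁅atU (G true), atV (G false)⁆ + ⁅atU (G false), atV (G true)⁆ = 0 := by
  constructor
  · exact fun h => ⟨fun s => h _ _ (.ww s), h _ _ .ww_symm, fun s => h _ _ (.ww_mixed s),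
      fun s => h _ _ (.ww_gg s), fun s => h _ _ (.gw s), fun s => h _ _ (.wg s),
      fun e s => h _ _ (.gw_symm e s), fun s => h _ _ (.gg s), h _ _ .gg_symm⟩
  · rintro ⟨h1, h2, h3, h4, h5, h6, h7, h8, h9⟩ _ _ (s | _ | s | s | s | s | ⟨e, s⟩ | s | _)
    exacts [h1 s, h2, h3 s, h4 s, h5 s, h6 s, h7 e s, h8 s, h9]

end CurrentRelations

section Shift

variable {F T : Type*} [Field F] [Ring T] [Algebra F T]

/-- Passing from `G_± = g, h` to the shifted and rescaled currents `B`, `C`: the value of the shift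
turns the homogeneous quadratic relations into the inhomogeneous ones, the terms of degree one
arising from the cross terms, and all dependence on `k_±` except through `ρ` scales out. -/
lemma shifted_iff {q kp km s₀ σ s c U V ρ : F} (hq : q ≠ 0) (hp : kp ≠ 0) (hm : km ≠ 0)
    (hσ : σ ≠ 0) (hs : s ≠ 0) (eσ : σ = q ^ 2 - 1) (es : s = q ^ 2 + 1) (ec : c = σ / q)
    (es₀ : s₀ = s / q) (eρ : ρ = kp * km * s₀ ^ 2)
    {p p' m m' g g' h h' B B' C C' : T}
    (eB : B = (1 / (km * s₀)) • g + (kp * s₀ / c) • 1)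
    (eB' : B' = (1 / (km * s₀)) • g' + (kp * s₀ / c) • 1)
    (eC : C = (1 / (kp * s₀)) • h + (km * s₀ / c) • 1)
    (eC' : C' = (1 / (kp * s₀)) • h' + (km * s₀ / c) • 1) :
    (B * B' - B' * B = 0 ↔ g * g' - g' * g = 0) ∧
    (C * C' - C' * C = 0 ↔ h * h' - h' * h = 0) ∧
    (OffDiagCurrent q c U V p p' m m' B B' ↔
      (U • (q • (g' * m) - q⁻¹ • (m * g')) - V • (q • (g * m') - q⁻¹ • (m' * g))
        - c • (p * g' - p' * g) + ρ • (U • m - V • m' - p + p') = 0 ∧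
      U • (q • (p * g') - q⁻¹ • (g' * p)) - V • (q • (p' * g) - q⁻¹ • (g * p'))
        - c • (m * g' - m' * g) + ρ • (U • p - V • p' - m + m') = 0 ∧
      (g * p' - p' * g) + (p * g' - g' * p) = 0 ∧
      (g * m' - m' * g) + (m * g' - g' * m) = 0)) ∧
    (OffDiagCurrent q c U V m m' p p' C C' ↔
      (U • (q • (h' * p) - q⁻¹ • (p * h')) - V • (q • (h * p') - q⁻¹ • (p' * h))
        - c • (m * h' - m' * h) + ρ • (U • p - V • p' - m + m') = 0 ∧
      U • (q • (m * h') - q⁻¹ • (h' * m)) - V • (q • (m' * h) - q⁻¹ • (h * m'))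
        - c • (p * h' - p' * h) + ρ • (U • m - V • m' - p + p') = 0 ∧
      (h * m' - m' * h) + (m * h' - h' * m) = 0 ∧
      (h * p' - p' * h) + (p * h' - h' * p) = 0)) ∧
    (DiagCurrent q s σ U V p p' m m' B B' C C' ↔
      ((p * p' - p' * p = 0 ∧ m * m' - m' * m = 0) ∧
      (p * m' - m' * p) + (m * p' - p' * m) = 0 ∧
      ((U - V) • (p * m' - m' * p) = (c / (ρ * s₀)) • (g * h' - g' * h)
          + (1 / s₀) • (g - h + h' - g') ∧
        (U - V) • (m * p' - p' * m) = (c / (ρ * s₀)) • (h * g' - h' * g)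
          + (1 / s₀) • (h - g + g' - h')) ∧
      ((U - V) • (p * p' - m * m' + (1 / (ρ * (q ^ 2 - q⁻¹ ^ 2))) • (g * h' - h' * g))
          + (1 - U * V) • (p * m' - p' * m) = 0 ∧
        (U - V) • (m * m' - p * p' + (1 / (ρ * (q ^ 2 - q⁻¹ ^ 2))) • (h * g' - g' * h))
          + (1 - U * V) • (m * p' - m' * p) = 0) ∧
      (g * h' - h' * g) + (h * g' - g' * h) = 0)) := by
  have hs₀ : s₀ ≠ 0 := by rw [es₀]; positivity
  have hc : c ≠ 0 := by rw [ec]; positivity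
  have hρ : ρ ≠ 0 := by rw [eρ]; positivity
  have nkp : 1 / (kp * s₀) ≠ 0 := one_div_ne_zero (mul_ne_zero hp hs₀)
  have nkm : 1 / (km * s₀) ≠ 0 := one_div_ne_zero (mul_ne_zero hm hs₀)
  have scale : ∀ {k : F} {x y : T}, k ≠ 0 → x = k • y → (x = 0 ↔ y = 0) := by
    rintro k x y hk rfl
    simp [hk]
  have hqq : q ^ 2 - q⁻¹ ^ 2 = σ * s / q ^ 2 := by
    rw [eσ, es]; field_simp; ring
  refine ⟨?_, ?_, ?_, ?_, ?_⟩
  · subst eB eB'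
    refine scale (k := (1 / (km * s₀)) ^ 2) (pow_ne_zero 2 nkm) ?_
    simp only [mul_add, add_mul, smul_mul_assoc, mul_smul_comm, mul_one, one_mul]
    module
  · subst eC eC'
    refine scale (k := (1 / (kp * s₀)) ^ 2) (pow_ne_zero 2 nkp) ?_
    simp only [mul_add, add_mul, smul_mul_assoc, mul_smul_comm, mul_one, one_mul]
    module
  · subst eB eB'
    refine and_congr ?_ (and_congr ?_ (and_congr ?_ ?_)) <;>
    · refine scale (k := 1 / (km * s₀)) nkm ?_
      simp only [mul_add, add_mul, smul_mul_assoc, mul_smul_comm, mul_one, one_mul]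
      subst ec eρ
      match_scalars <;> field_simp <;> rw [eσ] <;> ring
  · subst eC eC'
    refine and_congr ?_ (and_congr ?_ (and_congr ?_ ?_)) <;>
    · refine scale (k := 1 / (kp * s₀)) nkp ?_
      simp only [mul_add, add_mul, smul_mul_assoc, mul_smul_comm, mul_one, one_mul]
      subst ec eρ
      match_scalars <;> field_simp <;> rw [eσ] <;> ring
  · rw [hqq]
    have e1 : (σ / s) • (B * C' - B' * C) = (c / (ρ * s₀)) • (g * h' - g' * h)
          + (1 / s₀) • (g - h + h' - g') := by
      subst eB eB' eC eC' ec eρ es₀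
      simp only [mul_add, add_mul, smul_mul_assoc, mul_smul_comm, mul_one, one_mul]
      match_scalars <;> field_simp <;> ring
    have e2 : (σ / s) • (C * B' - C' * B) = (c / (ρ * s₀)) • (h * g' - h' * g)
          + (1 / s₀) • (h - g + g' - h') := by
      subst eB eB' eC eC' ec eρ es₀
      simp only [mul_add, add_mul, smul_mul_assoc, mul_smul_comm, mul_one, one_mul]
      match_scalars <;> field_simp <;> ring
    have e3 : B * C' - C' * B = ρ⁻¹ • (g * h' - h' * g) := by
      subst eB eB' eC eC' ec eρ es₀
      simp only [mul_add, add_mul, smul_mul_assoc, mul_smul_comm, mul_one, one_mul]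
      match_scalars <;> field_simp <;> ring
    have e4 : C * B' - B' * C = ρ⁻¹ • (h * g' - g' * h) := by
      subst eB eB' eC eC' ec eρ es₀
      simp only [mul_add, add_mul, smul_mul_assoc, mul_smul_comm, mul_one, one_mul]
      match_scalars <;> field_simp <;> ring
    have e5 : q ^ 2 / (σ * s) * ρ⁻¹ = 1 / (ρ * (σ * s / q ^ 2)) := by field_simp
    rw [DiagCurrent, e1, e2, e3, e4, smul_smul, smul_smul, e5, ← smul_add,
      smul_eq_zero_iff_right (inv_ne_zero hρ)]

end Shift

/-! ### Genericity of the spectral parameters -/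

section Generic

variable {F : Type*} [Field F]

/-- Over a field containing `ℂ`, the elements `u` and `v` have pairwise non-proportional
monomials. -/
def IndependentMonomials (ι : ℂ →+* F) (u v : F) : Prop :=
  ∀ (z : ℂ) (m n m' n' : ℕ), z ≠ 0 → (m, n) ≠ (m', n') → ι z * u ^ m * v ^ n ≠ u ^ m' * v ^ n'

/-- All denominators are differences of two non-proportional monomials, or polynomials in `q` that
vanish only at roots of unity. -/
lemma spectralScalars {ι : ℂ →+* F} {u v : F} (h : IndependentMonomials ι u v) {q : ℂ}
    (hq0 : q ≠ 0) (hq : ∀ n : ℕ, 0 < n → q ^ n ≠ 1) (hu : u ≠ 0) (hv : v ≠ 0) :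
    ∃ α β α' β' δ δ' η θ : F,
      SpectralScalars (ι q) u v (ι q ^ 2 + 1) (ι q ^ 2 - 1) α β α' β' δ δ' η θ
        (ι q * (u / v) - (ι q)⁻¹ * (u / v)⁻¹) (u / v - (u / v)⁻¹) (ι q - (ι q)⁻¹)
        (ι q * (u * v) - (ι q)⁻¹ * (u * v)⁻¹) (u * v - (u * v)⁻¹)
        ((ι q + (ι q)⁻¹)⁻¹ * (ι q * u ^ 2 + (ι q)⁻¹ * u⁻¹ ^ 2))
        ((ι q + (ι q)⁻¹)⁻¹ * (ι q * v ^ 2 + (ι q)⁻¹ * v⁻¹ ^ 2)) := by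
  have hQ : ι q ≠ 0 := (map_ne_zero ι).2 hq0
  have hs : ι q ^ 2 + 1 ≠ 0 := by
    rw [← map_pow, ← map_one ι, ← map_add, map_ne_zero]
    exact fun h => hq 4 (by norm_num) (by linear_combination (q ^ 2 - 1) * h)
  have hσ : ι q ^ 2 - 1 ≠ 0 := by
    rw [← map_pow, ← map_one ι, ← map_sub, map_ne_zero]
    exact sub_ne_zero.2 (hq 2 (by norm_num))
  have hg : ∀ k m n m' n' : ℕ, (m, n) ≠ (m', n') →
      ι q ^ k * u ^ m * v ^ n - u ^ m' * v ^ n' ≠ 0 := fun k m n m' n' hne => by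
    rw [← map_pow]
    exact sub_ne_zero.2 (h _ m n m' n' (pow_ne_zero k hq0) hne)
  refine ⟨_, _, _, _, _, _, _, _, hQ, hu, hv, hs, hσ, ?_, ?_, ?_, ?_, ?_, ?_, ?_, ?_,
    rfl, rfl, rfl, rfl, rfl, rfl, rfl, rfl, rfl, rfl, ?_, ?_, ?_, ?_, ?_, ?_, ?_⟩
  · simpa using hg 2 2 0 0 2 (by simp)
  · simpa using hg 0 2 0 0 2 (by simp)
  · simpa using hg 2 2 2 0 0 (by simp)
  · simpa using hg 0 2 2 0 0 (by simp)
  · simpa using hg 4 4 0 0 0 (by simp)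
  · simpa using hg 4 0 4 0 0 (by simp)
  · rw [← neg_ne_zero, neg_sub]
    simpa using hg 2 0 2 2 0 (by simp)
  · simpa using hg 4 2 2 0 0 (by simp)
  all_goals
    generalize ι q = Q at *
    field_simp

lemma smul_eq_zero_iff_of_ne_zero {T : Type*} [Ring T] [Algebra F T] {k : F} (hk : k ≠ 0)
    (x : T) : k • x = 0 ↔ x = 0 := by
  simp [hk]

end Generic

section Transfer

variable {S : Type*} [Ring S]

lemma atU_mul (f g : S⸨X⸩) : atU (f * g) = atU f * atU g := map_mul HahnSeries.C f g

lemma atU_add (f g : S⸨X⸩) : atU (f + g) = atU f + atU g := map_add HahnSeries.C f g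

lemma atU_sub (f g : S⸨X⸩) : atU (f - g) = atU f - atU g := map_sub HahnSeries.C f g

lemma atV_eq (f : S⸨X⸩) : atV f = laurentMap (HahnSeries.C : S →+* S⸨X⸩) f := rfl

lemma atV_mul (f g : S⸨X⸩) : atV (f * g) = atV f * atV g := by
  simp only [atV_eq, map_mul]

lemma atV_add (f g : S⸨X⸩) : atV (f + g) = atV f + atV g := by
  simp only [atV_eq, map_add]

lemma atV_sub (f g : S⸨X⸩) : atV (f - g) = atV f - atV g := by
  simp only [atV_eq, map_sub]

variable [Algebra ℂ S]

lemma atU_algebraMap (z : ℂ) : atU (algebraMap ℂ S⸨X⸩ z) = algebraMap ℂ (TwoSeries S) z := rfl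

lemma atV_algebraMap (z : ℂ) : atV (algebraMap ℂ S⸨X⸩ z) = algebraMap ℂ (TwoSeries S) z :=
  laurentMap_C (HahnSeries.C : S →+* S⸨X⸩) (algebraMap ℂ S z)

lemma atU_smul (z : ℂ) (f : S⸨X⸩) : atU (z • f) = z • atU f := by
  ext n m
  rcases eq_or_ne n 0 with rfl | h
  · simp [atU]
  · simp [atU, HahnSeries.coeff_single_of_ne h]

lemma atV_smul (z : ℂ) (f : S⸨X⸩) : atV (z • f) = z • atV f := by
  ext n m
  rcases eq_or_ne m 0 with rfl | h
  · simp [atV]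
  · simp [atV, HahnSeries.coeff_single_of_ne h]

/-- The equivalence, given a field `F` that contains `ℂ`, `u`, `v` and maps to the centre of
`S((u))((v))`. -/
theorem reflection_iff_current_of_scalars {F : Type*} [Field F]
    {τ : F →+* TwoSeries S} (hτ : ∀ r x, τ r * x = x * τ r)
    {ι : ℂ →+* F} {u v : F} (h : IndependentMonomials ι u v) (hun : u ≠ 0) (hvn : v ≠ 0)
    (hu : ((uVar : (TwoSeries S)ˣ) : TwoSeries S) = τ u)
    (hv : ((vVar : (TwoSeries S)ˣ) : TwoSeries S) = τ v)
    (hι : ∀ z : ℂ, algebraMap ℂ (TwoSeries S) z = τ (ι z))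
    {q kp km : ℂ} (hq0 : q ≠ 0) (hq : ∀ n : ℕ, 0 < n → q ^ n ≠ 1)
    (hkp : kp ≠ 0) (hkm : km ≠ 0) (W G : Bool → S⸨X⸩) :
    IsReflectionSolution q (currentMatrix q kp km W G) ↔
      IsCurrentSolution q (kp * km * (q + q⁻¹) ^ 2) W G := by
  let _ : Algebra F (TwoSeries S) := τ.toAlgebra' hτ
  have hmap : τ = algebraMap F (TwoSeries S) := rfl
  rw [hmap] at hu hv
  simp only [hmap] at hι
  obtain ⟨α, β, α', β', δ, δ', η, θ, H⟩ := spectralScalars h hq0 hq hun hvn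
  obtain ⟨U, eU⟩ : ∃ U, U = (ι q + (ι q)⁻¹)⁻¹ * (ι q * u ^ 2 + (ι q)⁻¹ * u⁻¹ ^ 2) := ⟨_, rfl⟩
  obtain ⟨V, eV⟩ : ∃ V, V = (ι q + (ι q)⁻¹)⁻¹ * (ι q * v ^ 2 + (ι q)⁻¹ * v⁻¹ ^ 2) := ⟨_, rfl⟩
  rw [← eU, ← eV] at H
  have hui : ((uVar⁻¹ : (TwoSeries S)ˣ) : TwoSeries S) = algebraMap F _ u⁻¹ := by
    refine (left_inv_eq_right_inv (a := ((uVar : (TwoSeries S)ˣ) : TwoSeries S)) ?_ ?_)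
    · exact Units.inv_mul _
    · rw [hu, ← map_mul, mul_inv_cancel₀ hun, map_one]
  have hvi : ((vVar⁻¹ : (TwoSeries S)ˣ) : TwoSeries S) = algebraMap F _ v⁻¹ := by
    refine (left_inv_eq_right_inv (a := ((vVar : (TwoSeries S)ˣ) : TwoSeries S)) ?_ ?_)
    · exact Units.inv_mul _
    · rw [hv, ← map_mul, mul_inv_cancel₀ hvn, map_one]
  have hz : ∀ (z : ℂ) (x : TwoSeries S), z • x = ι z • x := fun z x => by
    rw [Algebra.smul_def (ι z) x, ← hι]
    exact Algebra.smul_def z x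
  have hx : ((uVar / vVar : (TwoSeries S)ˣ) : TwoSeries S) = algebraMap F _ (u / v) := by
    rw [div_eq_mul_inv, Units.val_mul, hu, hvi, ← map_mul, ← div_eq_mul_inv]
  have hxi : (((uVar / vVar)⁻¹ : (TwoSeries S)ˣ) : TwoSeries S) = algebraMap F _ (u / v)⁻¹ := by
    rw [inv_div, inv_div, div_eq_mul_inv, Units.val_mul, hv, hui, ← map_mul, ← div_eq_mul_inv]
  have hy : ((uVar * vVar : (TwoSeries S)ˣ) : TwoSeries S) = algebraMap F _ (u * v) := by
    rw [Units.val_mul, hu, hv, ← map_mul]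
  have hyi : (((uVar * vVar)⁻¹ : (TwoSeries S)ˣ) : TwoSeries S) = algebraMap F _ (u * v)⁻¹ := by
    rw [mul_inv_rev, Units.val_mul, hui, hvi, ← map_mul, mul_inv_rev]
  have hU : symVar q (uVar : (TwoSeries S)ˣ) = algebraMap F _ U := by
    simp only [eU, symVar, hz, hu, hui, Algebra.smul_def, ← map_pow, ← map_mul, ← map_add,
      ← map_inv₀]
  have hV : symVar q (vVar : (TwoSeries S)ˣ) = algebraMap F _ V := by
    simp only [eV, symVar, hz, hv, hvi, Algebra.smul_def, ← map_pow, ← map_mul, ← map_add,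
      ← map_inv₀]
  have hXu : atU (HahnSeries.single 1 (1 : S)) = algebraMap F _ u := hu
  have hXui : atU (HahnSeries.single (-1) (1 : S)) = algebraMap F _ u⁻¹ := hui
  have hXv : atV (HahnSeries.single 1 (1 : S)) = algebraMap F _ v := by
    rw [← hv, atV_eq, laurentMap_single, map_one]; rfl
  have hXvi : atV (HahnSeries.single (-1) (1 : S)) = algebraMap F _ v⁻¹ := by
    rw [← hvi, atV_eq, laurentMap_single, map_one]; rfl
  have hKU : (currentMatrix q kp km W G).map atU =
    !![(u * ι q) • atU (W true) - (u * ι q)⁻¹ • atU (W false),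
       (1 / (ι km * (ι q + (ι q)⁻¹))) • atU (G true) +
         (ι kp * (ι q + (ι q)⁻¹) / (ι q - (ι q)⁻¹)) • 1;
       (1 / (ι kp * (ι q + (ι q)⁻¹))) • atU (G false) +
         (ι km * (ι q + (ι q)⁻¹) / (ι q - (ι q)⁻¹)) • 1,
       (u * ι q) • atU (W false) - (u * ι q)⁻¹ • atU (W true)] := by
    refine Matrix.ext fun i j => ?_
    fin_cases i <;> fin_cases j <;>
      simp [currentMatrix, atU_sub, atU_add, atU_smul, atU_mul, atU_algebraMap, hz, hι, hXu, hXui,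
        ← Algebra.smul_def, smul_smul, mul_comm, Algebra.algebraMap_eq_smul_one (A := TwoSeries S)]
  have hKV : (currentMatrix q kp km W G).map atV =
    !![(v * ι q) • atV (W true) - (v * ι q)⁻¹ • atV (W false),
       (1 / (ι km * (ι q + (ι q)⁻¹))) • atV (G true) +
         (ι kp * (ι q + (ι q)⁻¹) / (ι q - (ι q)⁻¹)) • 1;
       (1 / (ι kp * (ι q + (ι q)⁻¹))) • atV (G false) +
         (ι km * (ι q + (ι q)⁻¹) / (ι q - (ι q)⁻¹)) • 1,
       (v * ι q) • atV (W false) - (v * ι q)⁻¹ • atV (W true)] := by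
    refine Matrix.ext fun i j => ?_
    fin_cases i <;> fin_cases j <;>
      simp [currentMatrix, atV_sub, atV_add, atV_smul, atV_mul, atV_algebraMap, hz, hι, hXv, hXvi,
        ← Algebra.smul_def, smul_smul, mul_comm, Algebra.algebraMap_eq_smul_one (A := TwoSeries S)]
  obtain ⟨hB, hC, hBW, hCW, hD⟩ := shifted_iff (q := ι q) (kp := ι kp) (km := ι km)
    (s₀ := ι q + (ι q)⁻¹) (U := U) (V := V)
    (p := atU (W true)) (p' := atV (W true)) (m := atU (W false)) (m' := atV (W false))
    (g := atU (G true)) (g' := atV (G true)) (h := atU (G false)) (h' := atV (G false))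
    H.hq ((map_ne_zero ι).2 hkp) ((map_ne_zero ι).2 hkm) H.hσ H.hs H.eσ H.es H.ec
    (by have := H.hq; field_simp) rfl rfl rfl rfl rfl
  have hab : ∀ x : TwoSeries S,
      ((ι q * (u / v) - (ι q)⁻¹ * (u / v)⁻¹) * (u * v - (u * v)⁻¹)) • x = 0 ↔ x = 0 := by
    have hne : (ι q * (u / v) - (ι q)⁻¹ * (u / v)⁻¹) * (u * v - (u * v)⁻¹) ≠ 0 := by
      have h1 := H.hα
      have h2 := H.hβ'
      have h3 := H.hq
      rw [H.ea, H.eb']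
      positivity
    exact smul_eq_zero_iff_of_ne_zero hne
  rw [IsReflectionSolution, reflectionLHS, reflectionRHS,
    reflection_iff (F := F) (a := ι q * (u / v) - (ι q)⁻¹ * (u / v)⁻¹) (b := u / v - (u / v)⁻¹)
      (c := ι q - (ι q)⁻¹) (a' := ι q * (u * v) - (ι q)⁻¹ * (u * v)⁻¹)
      (b' := u * v - (u * v)⁻¹) ?_ ?_ ?_ ?_ ?_ hKU hKV,
    diag_iff H rfl rfl rfl rfl, offDiag_iff H rfl rfl rfl rfl, offDiag_iff H rfl rfl rfl rfl,
    hab, hab, hB, hC, hBW, hCW, hD, isCurrentSolution_iff]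
  · simp only [Bool.forall_bool, Bool.not_true, Bool.not_false, qComm, Ring.lie_def, hU, hV, hz,
      ← map_sub (algebraMap F (TwoSeries S)), ← map_mul (algebraMap F (TwoSeries S)),
      ← map_one (algebraMap F (TwoSeries S)), ← Algebra.smul_def]
    simp only [map_one, map_sub ι, map_mul ι, map_add ι, map_div₀ ι, map_inv₀ ι, map_pow ι]
    constructor
    · rintro ⟨⟨⟨pp, mm⟩, ws, ⟨x1, x2⟩, ⟨x3, x4⟩, gs⟩, ⟨y1, y2, y3, y4⟩, ⟨z1, z2, z3, z4⟩, bb, cc⟩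
      exact ⟨⟨mm, pp⟩, ws, ⟨x2, x1⟩, ⟨x4, x3⟩, ⟨y1, z1⟩, ⟨y2, z2⟩, ⟨⟨z3, z4⟩, ⟨y4, y3⟩⟩,
        ⟨cc, bb⟩, gs⟩
    · rintro ⟨⟨mm, pp⟩, ws, ⟨x2, x1⟩, ⟨x4, x3⟩, ⟨y1, z1⟩, ⟨y2, z2⟩, ⟨⟨z3, z4⟩, ⟨y4, y3⟩⟩,
        ⟨cc, bb⟩, gs⟩
      exact ⟨⟨⟨pp, mm⟩, ws, ⟨x1, x2⟩, ⟨x3, x4⟩, gs⟩, ⟨y1, y2, y3, y4⟩, ⟨z1, z2, z3, z4⟩, bb, cc⟩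
  · simp only [hz, hx, hxi, Algebra.smul_def, ← map_mul, ← map_sub, map_inv₀]
  · rw [hx, hxi, ← map_sub]
  · simp only [hz, hy, hyi, Algebra.smul_def, ← map_mul, ← map_sub, map_inv₀]
  · rw [hy, hyi, ← map_sub]
  · rw [hι, map_sub, map_inv₀]

end Transfer

/-! ### The field of scalars `ℂ((u))((v))` -/

section LaurentScalars

/-- The field `ℂ((u))((v))` of scalars. It is not reducible, so that instance search treats it as a
field and not as a ring of series. -/
def ScalarField : Type := ℂ⸨X⸩⸨X⸩

namespace ScalarField

instance : Field ScalarField := inferInstanceAs (Field ℂ⸨X⸩⸨X⸩)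

/-- The monomial `z u ^ m v ^ n`. -/
def monomial (m n : ℤ) (z : ℂ) : ScalarField :=
  (HahnSeries.single n (HahnSeries.single m z) : ℂ⸨X⸩⸨X⸩)

lemma monomial_mul (m n m' n' : ℤ) (z z' : ℂ) :
    monomial m n z * monomial m' n' z' = monomial (m + m') (n + n') (z * z') :=
  (HahnSeries.single_mul_single (R := ℂ⸨X⸩)).trans
    (congrArg (HahnSeries.single (n + n')) HahnSeries.single_mul_single)

lemma monomial_pow (m n : ℤ) (z : ℂ) (k : ℕ) :
    monomial m n z ^ k = monomial (k * m) (k * n) (z ^ k) := by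
  induction k with
  | zero => simp only [pow_zero, Nat.cast_zero, zero_mul]; rfl
  | succ k ih =>
    rw [pow_succ, ih, monomial_mul, pow_succ]
    congr 1 <;> push_cast <;> ring

lemma monomial_ne {m n m' n' : ℤ} {z z' : ℂ} (hz : z ≠ 0) (h : (m, n) ≠ (m', n')) :
    monomial m n z ≠ monomial m' n' z' := by
  intro h0
  have h1 := congrArg (fun f : ℂ⸨X⸩⸨X⸩ => (f.coeff n).coeff m) h0
  simp only [monomial, HahnSeries.coeff_single_same] at h1
  rcases eq_or_ne n n' with rfl | hn
  · rw [HahnSeries.coeff_single_same, HahnSeries.coeff_single_of_ne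
      fun hm => h (by rw [hm])] at h1
    exact hz h1
  · rw [HahnSeries.coeff_single_of_ne hn] at h1
    exact hz h1

/-- Complex numbers as constants of `ℂ((u))((v))`. -/
def const : ℂ →+* ScalarField where
  toFun z := monomial 0 0 z
  map_one' := rfl
  map_zero' := by simp only [monomial, map_zero]; rfl
  map_mul' z z' := (monomial_mul 0 0 0 0 z z').symm
  map_add' := map_add ((HahnSeries.C : ℂ⸨X⸩ →+* ℂ⸨X⸩⸨X⸩).comp (HahnSeries.C : ℂ →+* ℂ⸨X⸩))

lemma const_apply (z : ℂ) : const z = monomial 0 0 z := rfl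

lemma independentMonomials :
    IndependentMonomials const (monomial 1 0 1) (monomial 0 1 1) := by
  intro z m n m' n' hz hne
  simp only [const_apply, monomial_pow, monomial_mul]
  refine monomial_ne (by simpa using hz) fun h => hne ?_
  simpa using h

variable {S : Type*} [Ring S] [Algebra ℂ S]

/-- The action of the scalars on `S((u))((v))`. -/
def embed (S : Type*) [Ring S] [Algebra ℂ S] : ScalarField →+* TwoSeries S where
  toFun f := laurentMap (laurentMap (algebraMap ℂ S)) f
  map_one' := map_one (laurentMap (laurentMap (algebraMap ℂ S)))
  map_zero' := map_zero (laurentMap (laurentMap (algebraMap ℂ S)))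
  map_mul' := map_mul (laurentMap (laurentMap (algebraMap ℂ S)))
  map_add' := map_add (laurentMap (laurentMap (algebraMap ℂ S)))

lemma embed_commute (r : ScalarField) (x : TwoSeries S) : embed S r * x = x * embed S r :=
  laurentMap_commute (laurentMap_commute (φ := algebraMap ℂ S) Algebra.commutes) r x

lemma embed_monomial (m n : ℤ) (z : ℂ) : embed S (monomial m n z) =
    HahnSeries.single n (HahnSeries.single m (algebraMap ℂ S z)) := by
  change laurentMap (laurentMap (algebraMap ℂ S)) (HahnSeries.single n (HahnSeries.single m z)) = _
  rw [laurentMap_single, laurentMap_single]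

end ScalarField

open ScalarField in
/-- Over every algebra, the reflection equation for the matrix built from `W_±`, `G_±` is
equivalent to the current relations. -/
theorem reflection_iff_current {S : Type*} [Ring S] [Algebra ℂ S] {q kp km : ℂ} (hq0 : q ≠ 0)
    (hq : ∀ n : ℕ, 0 < n → q ^ n ≠ 1) (hkp : kp ≠ 0) (hkm : km ≠ 0) (W G : Bool → S⸨X⸩) :
    IsReflectionSolution q (currentMatrix q kp km W G) ↔
      IsCurrentSolution q (kp * km * (q + q⁻¹) ^ 2) W G := by
  have hzero : (0 : ScalarField) = monomial 0 0 0 := (map_zero const).symm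
  refine reflection_iff_current_of_scalars embed_commute independentMonomials ?_ ?_ ?_ ?_ ?_
    hq0 hq hkp hkm W G
  · rw [hzero]; exact monomial_ne one_ne_zero (by simp)
  · rw [hzero]; exact monomial_ne one_ne_zero (by simp)
  · rw [embed_monomial, map_one]; rfl
  · rw [embed_monomial, map_one]; rfl
  · intro z
    rw [const_apply, embed_monomial]; rfl

end LaurentScalars

/-! ### Recovering the currents from the matrix -/

section Inverse

variable {S : Type*} [Ring S]

/-- The coefficients of `f` at exponents less than `N` vanish. -/
def VanishBelow (N : ℤ) (f : S⸨X⸩) : Prop := ∀ n < N, f.coeff n = 0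

namespace VanishBelow

variable {N M : ℤ} {f g : S⸨X⸩}

lemma mono (h : M ≤ N) (hf : VanishBelow N f) : VanishBelow M f :=
  fun n hn => hf n (hn.trans_le h)

lemma add (hf : VanishBelow N f) (hg : VanishBelow N g) : VanishBelow N (f + g) :=
  fun n hn => by rw [HahnSeries.coeff_add, hf n hn, hg n hn, add_zero]

lemma neg (hf : VanishBelow N f) : VanishBelow N (-f) :=
  fun n hn => by rw [HahnSeries.coeff_neg, hf n hn, neg_zero]

lemma sub (hf : VanishBelow N f) (hg : VanishBelow N g) : VanishBelow N (f - g) := by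
  rw [sub_eq_add_neg]; exact hf.add hg.neg

lemma mul (hf : VanishBelow N f) (hg : VanishBelow M g) : VanishBelow (N + M) (f * g) := by
  intro n hn
  rw [HahnSeries.coeff_mul]
  refine Finset.sum_eq_zero fun i hi => ?_
  rw [Finset.mem_antidiagonal] at hi
  rcases lt_or_ge i.1 N with h | h
  · rw [hf _ h, zero_mul]
  · rw [hg i.2 (by omega), mul_zero]

lemma single (n : ℤ) (s : S) : VanishBelow n (HahnSeries.single n s) :=
  fun _ hm => HahnSeries.coeff_single_of_ne hm.ne

lemma smul [Algebra ℂ S] (z : ℂ) (hf : VanishBelow N f) : VanishBelow N (z • f) :=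
  fun n hn => by rw [HahnSeries.coeff_smul, hf n hn, smul_zero]

lemma map {S' : Type*} [Ring S'] (φ : S →+* S') (hf : VanishBelow N f) :
    VanishBelow N (laurentMap φ f) :=
  fun n hn => by rw [coeff_laurentMap, hf n hn, map_zero]

end VanishBelow

lemma vanishBelow_modeSeries (N : ℤ) (c : Set.Ici N → S) : VanishBelow N (modeSeries N c) :=
  fun _ hn => dif_neg hn.not_ge

lemma modeSeries_coeff {N : ℤ} {f : S⸨X⸩} (hf : VanishBelow N f) :
    modeSeries N (fun n => f.coeff n) = f := by
  refine HahnSeries.ext (funext fun n => ?_)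
  change (if _h : N ≤ n then f.coeff n else 0) = f.coeff n
  split_ifs with h
  · rfl
  · exact (hf n (not_le.1 h)).symm

lemma coeff_modeSeries {N : ℤ} (c : Set.Ici N → S) (n : Set.Ici N) :
    (modeSeries N c).coeff n = c n :=
  dif_pos n.2

variable [Algebra ℂ S]

/-- The inverse of `1 - q⁴ u⁴`, as a power series. -/
def geomInv (S : Type*) [Ring S] [Algebra ℂ S] (q : ℂ) : S⸨X⸩ :=
  laurentMap (algebraMap ℂ S)
    (HahnSeries.ofPowerSeries ℤ ℂ (1 - PowerSeries.C (q ^ 4) * PowerSeries.X ^ 4)⁻¹)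

lemma geomInv_commute (q : ℂ) (f : S⸨X⸩) : geomInv S q * f = f * geomInv S q :=
  laurentMap_commute Algebra.commutes _ f

lemma vanishBelow_geomInv (q : ℂ) : VanishBelow 0 (geomInv S q) := by
  refine VanishBelow.map _ fun n hn => ?_
  rw [HahnSeries.ofPowerSeries_apply]
  refine HahnSeries.embDomain_of_notMem_range ?_
  rintro ⟨k, hk⟩
  have : (k : ℤ) = n := hk
  omega

lemma geomInv_mul (q : ℂ) (f : S⸨X⸩) :
    geomInv S q * f - q ^ 4 • (geomInv S q * (HahnSeries.single 4 1 * f)) = f := by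
  have h : geomInv S q * (1 - q ^ 4 • HahnSeries.single 4 1) = 1 := by
    have h1 : (1 - PowerSeries.C (q ^ 4) * PowerSeries.X ^ 4)⁻¹ *
        (1 - PowerSeries.C (q ^ 4) * PowerSeries.X ^ 4) = 1 :=
      PowerSeries.inv_mul_cancel _ (by simp)
    have h2 := congrArg (fun p => laurentMap (algebraMap ℂ S) (HahnSeries.ofPowerSeries ℤ ℂ p)) h1
    simp only [map_mul, map_one, map_sub, HahnSeries.ofPowerSeries_C,
      HahnSeries.ofPowerSeries_X_pow, laurentMap_single, laurentMap_C, Nat.cast_ofNat] at h2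
    have h3 : q ^ 4 • (HahnSeries.single 4 1 : S⸨X⸩) =
        HahnSeries.C (algebraMap ℂ S (q ^ 4)) * HahnSeries.single 4 1 :=
      Algebra.smul_def (q ^ 4) (HahnSeries.single 4 1 : S⸨X⸩)
    exact (congrArg (fun t => geomInv S q * (1 - t)) h3).trans h2
  calc _ = geomInv S q * (1 - q ^ 4 • HahnSeries.single 4 1) * f := by
        rw [mul_sub, mul_one, sub_mul, mul_smul_comm, smul_mul_assoc, mul_assoc]
    _ = f := by rw [h, one_mul]

/-- The currents `W_±` recovered from the diagonal entries of `K`: the solution of the linear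
system in `currentMatrix`, whose determinant is `-q⁻² u⁻² (1 - q⁴ u⁴)`. -/
def currentW (q : ℂ) (K : Matrix (Fin 2) (Fin 2) S⸨X⸩) : Bool → S⸨X⸩
  | true => -(geomInv S q * (q ^ 3 • (HahnSeries.single 3 1 * K 0 0)
      + q • (HahnSeries.single 1 1 * K 1 1)))
  | false => -(geomInv S q * (q ^ 3 • (HahnSeries.single 3 1 * K 1 1)
      + q • (HahnSeries.single 1 1 * K 0 0)))

/-- The currents `G_±` recovered from the off-diagonal entries of `K`. -/
def currentG (q kp km : ℂ) (K : Matrix (Fin 2) (Fin 2) S⸨X⸩) : Bool → S⸨X⸩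
  | true => (km * (q + q⁻¹)) •
      (K 0 1 - algebraMap ℂ S⸨X⸩ (kp * (q + q⁻¹) / (q - q⁻¹)))
  | false => (kp * (q + q⁻¹)) •
      (K 1 0 - algebraMap ℂ S⸨X⸩ (km * (q + q⁻¹) / (q - q⁻¹)))

lemma currentW_currentMatrix {q : ℂ} (hq : q ≠ 0) (kp km : ℂ) (W G : Bool → S⸨X⸩) :
    currentW q (currentMatrix q kp km W G) = W := by
  funext s
  rw [← geomInv_mul q (W s)]
  cases s <;>
  · simp only [currentW, currentMatrix, Matrix.of_apply, Matrix.cons_val', Matrix.cons_val_zero,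
      Matrix.cons_val_one, Matrix.cons_val_fin_one, mul_sub, mul_add, mul_smul_comm, ← mul_assoc,
      HahnSeries.single_mul_single]
    norm_num
    match_scalars <;> field_simp <;> ring

lemma currentMatrix_currents {q kp km : ℂ} (hq : q ≠ 0) (hp : kp * (q + q⁻¹) ≠ 0)
    (hm : km * (q + q⁻¹) ≠ 0) (K : Matrix (Fin 2) (Fin 2) S⸨X⸩) :
    currentMatrix q kp km (currentW q K) (currentG q kp km K) = K := by
  have hc : ∀ n, HahnSeries.single n 1 * geomInv S q = geomInv S q * HahnSeries.single n 1 :=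
    fun n => (geomInv_commute q _).symm
  have hs : ∀ (f : S⸨X⸩) (m n : ℤ), f * HahnSeries.single m 1 * HahnSeries.single n 1 =
      f * HahnSeries.single (m + n) 1 := fun f m n => by
    rw [mul_assoc, HahnSeries.single_mul_single, mul_one]
  rw [← Matrix.ext_iff]
  simp only [Fin.forall_fin_two]
  refine ⟨⟨?_, ?_⟩, ?_, ?_⟩
  · conv_rhs => rw [← geomInv_mul q (K _ _)]
    simp [currentMatrix, currentW, mul_add, ← mul_assoc, hc, hs]
    match_scalars <;> field_simp <;> ring
  · simp only [currentMatrix, currentG, Matrix.of_apply, Matrix.cons_val', Matrix.cons_val_zero,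
      Matrix.cons_val_one, Matrix.cons_val_fin_one, smul_smul, one_div_mul_cancel hm, one_smul,
      sub_add_cancel]
  · simp only [currentMatrix, currentG, Matrix.of_apply, Matrix.cons_val', Matrix.cons_val_zero,
      Matrix.cons_val_one, Matrix.cons_val_fin_one, smul_smul, one_div_mul_cancel hp, one_smul,
      sub_add_cancel]
  · conv_rhs => rw [← geomInv_mul q (K _ _)]
    simp [currentMatrix, currentW, mul_add, ← mul_assoc, hc, hs]
    match_scalars <;> field_simp <;> ring

lemma currentG_currentMatrix {q kp km : ℂ} (hp : kp * (q + q⁻¹) ≠ 0) (hm : km * (q + q⁻¹) ≠ 0)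
    (W G : Bool → S⸨X⸩) :
    currentG q kp km (currentMatrix q kp km W G) = G := by
  funext s
  cases s
  · simp only [currentG, currentMatrix, Matrix.of_apply, Matrix.cons_val', Matrix.cons_val_zero,
      Matrix.cons_val_one, Matrix.cons_val_fin_one, add_sub_cancel_right, smul_smul,
      mul_one_div_cancel hp, one_smul]
  · simp only [currentG, currentMatrix, Matrix.of_apply, Matrix.cons_val', Matrix.cons_val_zero,
      Matrix.cons_val_one, Matrix.cons_val_fin_one, add_sub_cancel_right, smul_smul,
      mul_one_div_cancel hm, one_smul]

lemma vanishBelow_C {M : ℤ} (hM : M ≤ 0) (z : ℂ) : VanishBelow M (algebraMap ℂ S⸨X⸩ z) :=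
  (VanishBelow.single 0 (algebraMap ℂ S z)).mono hM

lemma vanishBelow_currentW {N : ℤ} (q : ℂ) {K : Matrix (Fin 2) (Fin 2) S⸨X⸩}
    (hK : ∀ i, VanishBelow N (K i i)) (s : Bool) : VanishBelow (N + 1) (currentW q K s) := by
  cases s <;>
  exact (((vanishBelow_geomInv q).mul
    ((((VanishBelow.single 3 1).mul (hK _)).mono (M := N + 1) (by omega)).smul _ |>.add
      ((((VanishBelow.single 1 1).mul (hK _)).mono (by omega)).smul _))).mono (by omega)).neg

lemma vanishBelow_currentG {M : ℤ} (hM : M ≤ 0) (q kp km : ℂ) {K : Matrix (Fin 2) (Fin 2) S⸨X⸩}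
    (h01 : VanishBelow M (K 0 1)) (h10 : VanishBelow M (K 1 0)) (s : Bool) :
    VanishBelow M (currentG q kp km K s) := by
  cases s
  · exact (h10.sub (vanishBelow_C hM _)).smul _
  · exact (h01.sub (vanishBelow_C hM _)).smul _

lemma vanishBelow_currentMatrix_diag {N : ℤ} (q kp km : ℂ) {W G : Bool → S⸨X⸩}
    (hW : ∀ s, VanishBelow (N + 1) (W s)) (i : Fin 2) :
    VanishBelow N (currentMatrix q kp km W G i i) := by
  have h : ∀ s t, VanishBelow N (q • (HahnSeries.single 1 1 * W s) -
      q⁻¹ • (HahnSeries.single (-1) 1 * W t)) := fun s t =>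
    ((((VanishBelow.single 1 1).mul (hW s)).mono (by omega)).smul q).sub
      ((((VanishBelow.single (-1) 1).mul (hW t)).mono (by omega)).smul q⁻¹)
  fin_cases i
  exacts [h true false, h false true]

lemma vanishBelow_currentMatrix_offDiag {M : ℤ} (hM : M ≤ 0) (q kp km : ℂ) {W G : Bool → S⸨X⸩}
    (hG : ∀ s, VanishBelow M (G s)) :
    VanishBelow M (currentMatrix q kp km W G 0 1) ∧
      VanishBelow M (currentMatrix q kp km W G 1 0) :=
  ⟨((hG true).smul _).add (vanishBelow_C hM _), ((hG false).smul _).add (vanishBelow_C hM _)⟩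

end Inverse

/-! ### Functoriality in the coefficient algebra -/

section Functoriality

variable {S S' : Type*} [Ring S] [Ring S'] [Algebra ℂ S] [Algebra ℂ S']

/-- Application of an algebra homomorphism to all coefficients of a Laurent series. -/
def algLaurentMap (φ : S →ₐ[ℂ] S') : S⸨X⸩ →ₐ[ℂ] S'⸨X⸩ where
  __ := laurentMap (φ : S →+* S')
  commutes' z := (laurentMap_C (φ : S →+* S') (algebraMap ℂ S z)).trans
    (congrArg HahnSeries.C (φ.commutes z))

@[simp]
lemma algLaurentMap_single (φ : S →ₐ[ℂ] S') (n : ℤ) (s : S) :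
    algLaurentMap φ (HahnSeries.single n s) = HahnSeries.single n (φ s) :=
  laurentMap_single (φ : S →+* S') n s

lemma algLaurentMap_modeSeries (φ : S →ₐ[ℂ] S') (N : ℤ) (c : Set.Ici N → S) :
    algLaurentMap φ (modeSeries N c) = modeSeries N fun n => φ (c n) := by
  ext n
  change φ (if h : N ≤ n then c ⟨n, h⟩ else 0) = if h : N ≤ n then φ (c ⟨n, h⟩) else 0
  split_ifs
  · rfl
  · exact map_zero φ

/-- Application of an algebra homomorphism to all coefficients of a series in `u` and `v`. -/
abbrev twoSeriesMap (φ : S →ₐ[ℂ] S') : TwoSeries S →ₐ[ℂ] TwoSeries S' :=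
  algLaurentMap (algLaurentMap φ)

lemma twoSeriesMap_atU (φ : S →ₐ[ℂ] S') (f : S⸨X⸩) :
    twoSeriesMap φ (atU f) = atU (algLaurentMap φ f) := algLaurentMap_single _ 0 f

lemma twoSeriesMap_atV (φ : S →ₐ[ℂ] S') (f : S⸨X⸩) :
    twoSeriesMap φ (atV f) = atV (algLaurentMap φ f) := by
  refine HahnSeries.ext (funext fun n => ?_)
  exact algLaurentMap_single φ 0 (f.coeff n)

lemma twoSeriesMap_uVar (φ : S →ₐ[ℂ] S') :
    Units.map (twoSeriesMap φ : TwoSeries S →* TwoSeries S') uVar = uVar := by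
  ext1
  change twoSeriesMap φ (HahnSeries.single 0 (HahnSeries.single 1 1)) = _
  rw [algLaurentMap_single, algLaurentMap_single, map_one]; rfl

lemma twoSeriesMap_vVar (φ : S →ₐ[ℂ] S') :
    Units.map (twoSeriesMap φ : TwoSeries S →* TwoSeries S') vVar = vVar := by
  ext1
  change twoSeriesMap φ (HahnSeries.single 1 1) = _
  rw [algLaurentMap_single, map_one]; rfl

lemma map_RMatrix (φ : S →ₐ[ℂ] S') (q : ℂ) (x : Sˣ) :
    (RMatrix q x).map φ = RMatrix q (Units.map (φ : S →* S') x) := by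
  ext r s
  simp only [RMatrix, Matrix.map_apply, Matrix.of_apply]
  split_ifs <;> simp

lemma map_symVar (φ : S →ₐ[ℂ] S') (q : ℂ) (x : Sˣ) :
    φ (symVar q x) = symVar q (Units.map (φ : S →* S') x) := by
  simp [symVar]

lemma map_kronecker_one (φ : S →ₐ[ℂ] S') (M : Matrix (Fin 2) (Fin 2) S) :
    (M ⊗ₖ (1 : Matrix (Fin 2) (Fin 2) S)).map φ = M.map φ ⊗ₖ 1 := by
  ext r s
  simp only [Matrix.map_apply, Matrix.kroneckerMap_apply, Matrix.one_apply]
  split_ifs <;> simp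

lemma map_one_kronecker (φ : S →ₐ[ℂ] S') (M : Matrix (Fin 2) (Fin 2) S) :
    ((1 : Matrix (Fin 2) (Fin 2) S) ⊗ₖ M).map φ = 1 ⊗ₖ M.map φ := by
  ext r s
  simp only [Matrix.map_apply, Matrix.kroneckerMap_apply, Matrix.one_apply]
  split_ifs <;> simp

lemma reflectionLHS_map (φ : S →ₐ[ℂ] S') (q : ℂ) (K : Matrix (Fin 2) (Fin 2) S⸨X⸩) :
    reflectionLHS q (K.map (algLaurentMap φ)) = (reflectionLHS q K).map (twoSeriesMap φ) := by
  have hU : (K.map (algLaurentMap φ)).map atU = (K.map atU).map (twoSeriesMap φ) := by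
    ext1 i j; exact (twoSeriesMap_atU φ _).symm
  have hV : (K.map (algLaurentMap φ)).map atV = (K.map atV).map (twoSeriesMap φ) := by
    ext1 i j; exact (twoSeriesMap_atV φ _).symm
  rw [reflectionLHS, reflectionLHS, Matrix.map_mul, Matrix.map_mul, Matrix.map_mul, map_RMatrix,
    map_RMatrix, map_kronecker_one, map_one_kronecker, hU, hV, map_div, map_mul, twoSeriesMap_uVar,
    twoSeriesMap_vVar]

lemma reflectionRHS_map (φ : S →ₐ[ℂ] S') (q : ℂ) (K : Matrix (Fin 2) (Fin 2) S⸨X⸩) :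
    reflectionRHS q (K.map (algLaurentMap φ)) = (reflectionRHS q K).map (twoSeriesMap φ) := by
  have hU : (K.map (algLaurentMap φ)).map atU = (K.map atU).map (twoSeriesMap φ) := by
    ext1 i j; exact (twoSeriesMap_atU φ _).symm
  have hV : (K.map (algLaurentMap φ)).map atV = (K.map atV).map (twoSeriesMap φ) := by
    ext1 i j; exact (twoSeriesMap_atV φ _).symm
  rw [reflectionRHS, reflectionRHS, Matrix.map_mul, Matrix.map_mul, Matrix.map_mul, map_RMatrix,
    map_RMatrix, map_kronecker_one, map_one_kronecker, hU, hV, map_div, map_mul, twoSeriesMap_uVar,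
    twoSeriesMap_vVar]

/-- A matrix solves the reflection equation after a change of coefficients if and only if the
homomorphism identifies the coefficients of both sides. -/
lemma isReflectionSolution_map_iff (φ : S →ₐ[ℂ] S') (q : ℂ) (K : Matrix (Fin 2) (Fin 2) S⸨X⸩) :
    IsReflectionSolution q (K.map (algLaurentMap φ)) ↔
      ∀ r s m n, φ (coeffUV (reflectionLHS q K r s) m n) =
        φ (coeffUV (reflectionRHS q K r s) m n) := by
  rw [IsReflectionSolution, reflectionLHS_map, reflectionRHS_map, ← Matrix.ext_iff]
  refine forall₂_congr fun r s => ⟨fun h m n => ?_, fun h => twoSeries_ext h⟩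
  exact congrArg (fun f => coeffUV f m n) h

/-- Currents satisfy the relations after a change of coefficients if and only if the homomorphism
identifies the coefficients of both sides of each relation. -/
lemma isCurrentSolution_map_iff (φ : S →ₐ[ℂ] S') (q ρ : ℂ) (W G : Bool → S⸨X⸩) :
    IsCurrentSolution q ρ (fun s => algLaurentMap φ (W s)) (fun s => algLaurentMap φ (G s)) ↔
      ∀ x y, CurrentEq q ρ W G x y → twoSeriesMap φ x = twoSeriesMap φ y := by
  have hU : symVar q (uVar : (TwoSeries S')ˣ) = twoSeriesMap φ (symVar q uVar) := by
    rw [map_symVar, twoSeriesMap_uVar]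
  have hV : symVar q (vVar : (TwoSeries S')ˣ) = twoSeriesMap φ (symVar q vVar) := by
    rw [map_symVar, twoSeriesMap_vVar]
  rw [isCurrentSolution_iff]
  simp only [qComm, hU, hV, ← twoSeriesMap_atU, ← twoSeriesMap_atV]
  constructor
  · rintro ⟨h1, h2, h3, h4, h5, h6, h7, h8, h9⟩ _ _ (s | _ | s | s | s | s | ⟨e, s⟩ | s | _)
    · simpa [Ring.lie_def] using h1 s
    · simpa [Ring.lie_def] using h2
    · simpa [Ring.lie_def] using h3 s
    · simpa [Ring.lie_def] using h4 s
    · simpa [qComm] using h5 s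
    · simpa [qComm] using h6 s
    · simpa [Ring.lie_def] using h7 e s
    · simpa [Ring.lie_def] using h8 s
    · simpa [Ring.lie_def] using h9
  · intro h
    refine ⟨fun s => ?_, ?_, fun s => ?_, fun s => ?_, fun s => ?_, fun s => ?_, fun e s => ?_,
      fun s => ?_, ?_⟩
    · simpa [Ring.lie_def] using h _ _ (.ww s)
    · simpa [Ring.lie_def] using h _ _ .ww_symm
    · simpa [Ring.lie_def] using h _ _ (.ww_mixed s)
    · simpa [Ring.lie_def] using h _ _ (.ww_gg s)
    · simpa [qComm] using h _ _ (.gw s)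
    · simpa [qComm] using h _ _ (.wg s)
    · simpa [Ring.lie_def] using h _ _ (.gw_symm e s)
    · simpa [Ring.lie_def] using h _ _ (.gg s)
    · simpa [Ring.lie_def] using h _ _ .gg_symm

lemma currentMatrix_map (φ : S →ₐ[ℂ] S') (q kp km : ℂ) (W G : Bool → S⸨X⸩) :
    (currentMatrix q kp km W G).map (algLaurentMap φ) =
      currentMatrix q kp km (fun s => algLaurentMap φ (W s)) (fun s => algLaurentMap φ (G s)) := by
  rw [← Matrix.ext_iff]
  simp only [Fin.forall_fin_two]
  refine ⟨⟨?_, ?_⟩, ?_, ?_⟩ <;>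
  · simp only [currentMatrix, Matrix.map_apply, Matrix.of_apply, Matrix.cons_val',
      Matrix.cons_val_zero, Matrix.cons_val_one, Matrix.cons_val_fin_one, map_sub, map_add,
      map_smul, map_mul, algLaurentMap_single, map_one, AlgHom.commutes]

end Functoriality

/-! ### Universal properties of the two algebras -/

section Universal

variable {S : Type*} [Ring S] [Algebra ℂ S]

lemma vanishBelow_algLaurentMap {S' : Type*} [Ring S'] [Algebra ℂ S'] (φ : S →ₐ[ℂ] S') {N : ℤ}
    {f : S⸨X⸩} (hf : VanishBelow N f) : VanishBelow N (algLaurentMap φ f) :=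
  hf.map (φ : S →+* S')

namespace ReflectionAlgebra

variable {q : ℂ} {N M : ℤ}

lemma isReflectionSolution_K : IsReflectionSolution q (K q N M) :=
  (isReflectionSolution_map_iff (RingQuot.mkAlgHom ℂ (ReflectionRel q N M)) q (freeK N M)).2
    fun r s m n => RingQuot.mkAlgHom_rel ℂ ⟨r, s, m, n, rfl, rfl⟩

lemma vanishBelow_K_diag (i : Fin 2) : VanishBelow N (K q N M i i) := by
  refine vanishBelow_algLaurentMap (RingQuot.mkAlgHom ℂ (ReflectionRel q N M)) ?_
  fin_cases i <;> simp [freeK, vanishBelow_modeSeries]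

lemma vanishBelow_K_zero_one : VanishBelow M (K q N M 0 1) :=
  vanishBelow_algLaurentMap (RingQuot.mkAlgHom ℂ (ReflectionRel q N M))
    (by simp [freeK, vanishBelow_modeSeries])

lemma vanishBelow_K_one_zero : VanishBelow M (K q N M 1 0) :=
  vanishBelow_algLaurentMap (RingQuot.mkAlgHom ℂ (ReflectionRel q N M))
    (by simp [freeK, vanishBelow_modeSeries])

/-- A solution of the reflection equation with the prescribed orders is the image of the
generating matrix under an algebra homomorphism. -/
lemma exists_lift {k : Matrix (Fin 2) (Fin 2) S⸨X⸩} (hk : IsReflectionSolution q k)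
    (hd : ∀ i, VanishBelow N (k i i)) (h01 : VanishBelow M (k 0 1)) (h10 : VanishBelow M (k 1 0)) :
    ∃ φ : ReflectionAlgebra q N M →ₐ[ℂ] S, (K q N M).map (algLaurentMap φ) = k := by
  let g : ReflectionGen N M → S
    | .A n => (k 0 0).coeff n
    | .B n => (k 0 1).coeff n
    | .C n => (k 1 0).coeff n
    | .D n => (k 1 1).coeff n
  have hfree : (freeK N M).map (algLaurentMap (FreeAlgebra.lift ℂ g)) = k := by
    rw [← Matrix.ext_iff]
    simp only [Fin.forall_fin_two]
    simp only [freeK, Matrix.map_apply, Matrix.of_apply, Matrix.cons_val', Matrix.cons_val_zero,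
      Matrix.cons_val_one, Matrix.cons_val_fin_one, algLaurentMap_modeSeries,
      FreeAlgebra.lift_ι_apply, g]
    exact ⟨⟨modeSeries_coeff (hd 0), modeSeries_coeff h01⟩, modeSeries_coeff h10,
      modeSeries_coeff (hd 1)⟩
  have hrel : ∀ ⦃a b⦄, ReflectionRel q N M a b →
      FreeAlgebra.lift ℂ g a = FreeAlgebra.lift ℂ g b := by
    rintro _ _ ⟨r, s, m, n, rfl, rfl⟩
    rw [← hfree] at hk
    exact (isReflectionSolution_map_iff _ q _).1 hk r s m n
  refine ⟨RingQuot.liftAlgHom ℂ ⟨FreeAlgebra.lift ℂ g, hrel⟩, ?_⟩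
  rw [← hfree]
  ext i j n
  exact RingQuot.liftAlgHom_mkAlgHom_apply ℂ _ hrel _

lemma algHom_ext {φ ψ : ReflectionAlgebra q N M →ₐ[ℂ] S}
    (h : (K q N M).map (algLaurentMap φ) = (K q N M).map (algLaurentMap ψ)) : φ = ψ := by
  refine RingQuot.ringQuot_ext' ℂ _ _ (FreeAlgebra.hom_ext (funext fun x => ?_))
  have key : ∀ i j (n : ℤ),
      φ (RingQuot.mkAlgHom ℂ (ReflectionRel q N M) ((freeK N M i j).coeff n)) =
        ψ (RingQuot.mkAlgHom ℂ (ReflectionRel q N M) ((freeK N M i j).coeff n)) :=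
    fun i j n => congrArg (fun f => (f i j).coeff n) h
  rcases x with n | n | n | n
  · simpa [freeK, coeff_modeSeries] using key 0 0 n
  · simpa [freeK, coeff_modeSeries] using key 0 1 n
  · simpa [freeK, coeff_modeSeries] using key 1 0 n
  · simpa [freeK, coeff_modeSeries] using key 1 1 n

end ReflectionAlgebra

namespace CurrentAlgebra

variable {q ρ : ℂ} {N M : ℤ}

lemma isCurrentSolution_W_G : IsCurrentSolution q ρ (W q ρ N M) (G q ρ N M) :=
  (isCurrentSolution_map_iff (RingQuot.mkAlgHom ℂ (CurrentRel q ρ N M)) q ρ (freeW N M)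
    (freeG N M)).2 fun x y h => twoSeries_ext fun m n =>
      RingQuot.mkAlgHom_rel ℂ ⟨x, y, h, m, n, rfl, rfl⟩

lemma vanishBelow_W (s : Bool) : VanishBelow N (W q ρ N M s) :=
  vanishBelow_algLaurentMap (RingQuot.mkAlgHom ℂ (CurrentRel q ρ N M))
    (vanishBelow_modeSeries N _)

lemma vanishBelow_G (s : Bool) : VanishBelow M (G q ρ N M s) :=
  vanishBelow_algLaurentMap (RingQuot.mkAlgHom ℂ (CurrentRel q ρ N M))
    (vanishBelow_modeSeries M _)

/-- Solutions of the current relations with the prescribed orders are the images of the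
generating currents under an algebra homomorphism. -/
lemma exists_lift {w g : Bool → S⸨X⸩} (h : IsCurrentSolution q ρ w g)
    (hw : ∀ s, VanishBelow N (w s)) (hg : ∀ s, VanishBelow M (g s)) :
    ∃ φ : CurrentAlgebra q ρ N M →ₐ[ℂ] S,
      (fun s => algLaurentMap φ (W q ρ N M s)) = w ∧
        (fun s => algLaurentMap φ (G q ρ N M s)) = g := by
  let c : CurrentGen N M → S
    | .W s n => (w s).coeff n
    | .G s n => (g s).coeff n
  have hW : (fun s => algLaurentMap (FreeAlgebra.lift ℂ c) (freeW N M s)) = w := by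
    funext s
    refine (algLaurentMap_modeSeries _ _ _).trans ?_
    simp only [FreeAlgebra.lift_ι_apply, c]
    exact modeSeries_coeff (hw s)
  have hG : (fun s => algLaurentMap (FreeAlgebra.lift ℂ c) (freeG N M s)) = g := by
    funext s
    refine (algLaurentMap_modeSeries _ _ _).trans ?_
    simp only [FreeAlgebra.lift_ι_apply, c]
    exact modeSeries_coeff (hg s)
  have hrel : ∀ ⦃a b⦄, CurrentRel q ρ N M a b →
      FreeAlgebra.lift ℂ c a = FreeAlgebra.lift ℂ c b := by
    rintro _ _ ⟨x, y, hxy, m, n, rfl, rfl⟩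
    rw [← hW, ← hG] at h
    exact congrArg (fun f => coeffUV f m n) ((isCurrentSolution_map_iff _ q ρ _ _).1 h x y hxy)
  refine ⟨RingQuot.liftAlgHom ℂ ⟨FreeAlgebra.lift ℂ c, hrel⟩, ?_, ?_⟩
  · rw [← hW]
    ext s n
    exact RingQuot.liftAlgHom_mkAlgHom_apply ℂ _ hrel _
  · rw [← hG]
    ext s n
    exact RingQuot.liftAlgHom_mkAlgHom_apply ℂ _ hrel _

lemma algHom_ext {φ ψ : CurrentAlgebra q ρ N M →ₐ[ℂ] S}
    (hW : (fun s => algLaurentMap φ (W q ρ N M s)) = fun s => algLaurentMap ψ (W q ρ N M s))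
    (hG : (fun s => algLaurentMap φ (G q ρ N M s)) = fun s => algLaurentMap ψ (G q ρ N M s)) :
    φ = ψ := by
  refine RingQuot.ringQuot_ext' ℂ _ _ (FreeAlgebra.hom_ext (funext fun x => ?_))
  have keyW : ∀ s (n : ℤ), φ (RingQuot.mkAlgHom ℂ (CurrentRel q ρ N M) ((freeW N M s).coeff n)) =
      ψ (RingQuot.mkAlgHom ℂ (CurrentRel q ρ N M) ((freeW N M s).coeff n)) :=
    fun s n => congrArg (fun f => (f s).coeff n) hW
  have keyG : ∀ s (n : ℤ), φ (RingQuot.mkAlgHom ℂ (CurrentRel q ρ N M) ((freeG N M s).coeff n)) =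
      ψ (RingQuot.mkAlgHom ℂ (CurrentRel q ρ N M) ((freeG N M s).coeff n)) :=
    fun s n => congrArg (fun f => (f s).coeff n) hG
  rcases x with ⟨s, n⟩ | ⟨s, n⟩
  · simpa [freeW, coeff_modeSeries] using keyW s n
  · simpa [freeG, coeff_modeSeries] using keyG s n

end CurrentAlgebra

end Universal

/-! ### The isomorphism -/

lemma isPhi_iff {q kp km ρ : ℂ} {N M N' M' : ℤ}
    (Φ : ReflectionAlgebra q N M →ₐ[ℂ] CurrentAlgebra q ρ N' M') :
    IsPhi q kp km Φ ↔ (ReflectionAlgebra.K q N M).map (algLaurentMap Φ) =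
      currentMatrix q kp km (CurrentAlgebra.W q ρ N' M') (CurrentAlgebra.G q ρ N' M') :=
  Matrix.ext_iff

/-- The assignment `currentMatrix` and its inverse both extend to homomorphisms, by the universal properties
and the equivalence of the two families of relations over every algebra. -/
lemma exists_algEquiv_isPhi {q kp km : ℂ} (hq0 : q ≠ 0) (hq : ∀ n : ℕ, 0 < n → q ^ n ≠ 1)
    (hkp : kp ≠ 0) (hkm : km ≠ 0) (N : ℤ) {M : ℤ} (hM : M ≤ 0) :
    ∃ Φ : ReflectionAlgebra q N M ≃ₐ[ℂ] CurrentAlgebra q (kp * km * (q + q⁻¹) ^ 2) (N + 1) M,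
      IsPhi q kp km Φ.toAlgHom := by
  have hs : q + q⁻¹ ≠ 0 := by
    intro h
    have h2 : q ^ 2 = -1 := by
      field_simp at h
      linear_combination h
    exact hq 4 (by norm_num) (by linear_combination (q ^ 2 - 1) * h2)
  have hp : kp * (q + q⁻¹) ≠ 0 := mul_ne_zero hkp hs
  have hm : km * (q + q⁻¹) ≠ 0 := mul_ne_zero hkm hs
  set ρ := kp * km * (q + q⁻¹) ^ 2 with hρ
  set K := ReflectionAlgebra.K q N M with hK
  set W := CurrentAlgebra.W q ρ (N + 1) M
  set G := CurrentAlgebra.G q ρ (N + 1) M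
  have hoff := vanishBelow_currentMatrix_offDiag hM q kp km (W := W) (G := G)
    CurrentAlgebra.vanishBelow_G
  obtain ⟨Φ, hΦ⟩ := ReflectionAlgebra.exists_lift (N := N) (M := M)
    ((reflection_iff_current hq0 hq hkp hkm W G).2 CurrentAlgebra.isCurrentSolution_W_G)
    (vanishBelow_currentMatrix_diag q kp km CurrentAlgebra.vanishBelow_W) hoff.1 hoff.2
  have hsol : IsCurrentSolution q ρ (currentW q K) (currentG q kp km K) := by
    refine (reflection_iff_current hq0 hq hkp hkm _ _).1 ?_
    rw [currentMatrix_currents hq0 hp hm]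
    exact ReflectionAlgebra.isReflectionSolution_K
  obtain ⟨Ψ, hΨW, hΨG⟩ := CurrentAlgebra.exists_lift (N := N + 1) (M := M) hsol
    (vanishBelow_currentW q ReflectionAlgebra.vanishBelow_K_diag)
    (vanishBelow_currentG hM q kp km ReflectionAlgebra.vanishBelow_K_zero_one
      ReflectionAlgebra.vanishBelow_K_one_zero)
  have hΨΦ : Ψ.comp Φ = AlgHom.id ℂ _ := by
    refine ReflectionAlgebra.algHom_ext ?_
    calc K.map (algLaurentMap (Ψ.comp Φ))
        = (K.map (algLaurentMap Φ)).map (algLaurentMap Ψ) := rfl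
      _ = K := by
          rw [hΦ, currentMatrix_map, hΨW, hΨG, currentMatrix_currents hq0 hp hm]
  -- `Φ` applied to the currents recovered from `K` gives currents with the same matrix as the
  -- generating ones; since the currents are determined by their matrix, both coincide.
  have hmat : currentMatrix q kp km (fun s => algLaurentMap Φ (currentW q K s))
      (fun s => algLaurentMap Φ (currentG q kp km K s)) = currentMatrix q kp km W G := by
    rw [← currentMatrix_map, currentMatrix_currents hq0 hp hm, hΦ]
  have hΦΨ : Φ.comp Ψ = AlgHom.id ℂ _ := by
    refine CurrentAlgebra.algHom_ext ?_ ?_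
    · calc (fun s => algLaurentMap (Φ.comp Ψ) (W s))
          = fun s => algLaurentMap Φ ((fun s => algLaurentMap Ψ (W s)) s) := rfl
        _ = W := by
          rw [hΨW, ← currentW_currentMatrix hq0 kp km (fun s => algLaurentMap Φ (currentW q K s))
            fun s => algLaurentMap Φ (currentG q kp km K s), hmat, currentW_currentMatrix hq0]
    · calc (fun s => algLaurentMap (Φ.comp Ψ) (G s))
          = fun s => algLaurentMap Φ ((fun s => algLaurentMap Ψ (G s)) s) := rfl
        _ = G := by
          rw [hΨG, ← currentG_currentMatrix hp hm (fun s => algLaurentMap Φ (currentW q K s))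
            fun s => algLaurentMap Φ (currentG q kp km K s), hmat, currentG_currentMatrix hp hm]
  exact ⟨AlgEquiv.ofAlgHom Φ Ψ hΦΨ hΨΦ, (isPhi_iff Φ).2 hΦ⟩

end ReflectionCurrent

end

open ReflectionCurrent in
theorem theorem1 (q kp km : ℂ) (hq0 : q ≠ 0) (hq : ∀ n : ℕ, 0 < n → q ^ n ≠ 1)
    (hkp : kp ≠ 0) (hkm : km ≠ 0) :
    (∀ (S : Type*) [Ring S] [Algebra ℂ S] (W G : Bool → S⸨X⸩),
      IsReflectionSolution q (currentMatrix q kp km W G) ↔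
        IsCurrentSolution q (kp * km * (q + q⁻¹) ^ 2) W G) ∧
    ∀ N M : ℤ, M ≤ 0 →
      ∃ Φ : ReflectionAlgebra q N M ≃ₐ[ℂ]
          CurrentAlgebra q (kp * km * (q + q⁻¹) ^ 2) (N + 1) M,
        IsPhi q kp km Φ.toAlgHom ∧
        ∀ Ψ : ReflectionAlgebra q N M →ₐ[ℂ]
            CurrentAlgebra q (kp * km * (q + q⁻¹) ^ 2) (N + 1) M,
          IsPhi q kp km Ψ → Ψ = Φ.toAlgHom := by
  refine ⟨fun S _ _ W G => reflection_iff_current hq0 hq hkp hkm W G, fun N M hM => ?_⟩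
  obtain ⟨Φ, hΦ⟩ := exists_algEquiv_isPhi hq0 hq hkp hkm N hM
  exact ⟨Φ, hΦ, fun Ψ hΨ => ReflectionAlgebra.algHom_ext
    (((isPhi_iff Ψ).1 hΨ).trans ((isPhi_iff _).1 hΦ).symm)⟩
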